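/- Let $d\ge 0$, let $X\subseteq\mathbb R^d$ be open, and let $\psi:X\to X$ be smooth and bijective with $\det J\psi(x)\neq 0$ for every $x\in X$, where $J\psi$ denotes the Jacobian matrix. Let $\mathscr D(X)$ be the space of complex-valued test functions on $X$ with its usual locally convex topology, and let $\mathscr D'(X)$ be the space of distributions on $X$ with the strong dual topology. Let $C_\psi$ be the composition operator on $\mathscr D'(X)$, i.e. the unique continuous linear operator on $\mathscr D'(X)$ which extends $f\mapsto f\circ\psi$ on $C(X)$; explicitly, $$\langle C_\psi u,\varphi\rangle=\Big\langle u,\frac{\varphi}{|\det J\psi|}\circ\psi^{-1}\Big\rangle\qquad(u\in\mathscr D'(X),\ \varphi\in\mathscr D(X)).$$ Then the following are equivalent. (i) $C_\psi$ is power bounded on $\mathscr D'(X)$, i.e. for every continuous seminorm $p$ on $\mathscr D'(X)$ there is a continuous seminorm $q$ on $\mathscr D'(X)$ such that $p(C_\psi^m u)\le q(u)$ for all $m\in\mathbb N_0$ and all $u\in\mathscr D'(X)$. (ii) $\psi$ has stable orbits, i.e. for every compact $K\subseteq X$ there is a compact $L\subseteq X$ such that $\psi^m(K)\subseteq L$ for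 all $m\in\mathbb N_0$; and for every compact $K\subseteq X$, every $n\in\mathbb N_0$ and every $1\le c\le d$, $$\sup_{m\in\mathbb N_0}\ \sup_{|\alpha|\le n,\ x\in\psi^m(K)}\big|\partial^\alpha(\psi^{-m})_c(x)\big|<\infty,$$ where $\psi^{-m}=(\psi^{-1})^m$ and $(\psi^{-m})_c$ denotes its $c$-th component. -/

import Mathlib

open Set Filter MeasureTheory TopologicalSpace
open scoped Topology ContDiff ENNReal Distributions

namespace CompositionOp

/-- Euclidean space `ℝ^d`. -/
abbrev Euc (d : ℕ) : Type := EuclideanSpace ℝ (Fin d)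

/-- The space `𝓓'(X)` of (complex) distributions on the open set `X ⊆ ℝ^d`: the continuous
`ℂ`-linear forms on the LF-space `𝓓(X)` of complex test functions. The topology which Mathlib
puts on this space of continuous linear forms is the strong dual topology (uniform convergence
on the bounded subsets of `𝓓(X)`). -/
abbrev Distr {d : ℕ} (X : Opens (Euc d)) : Type := 𝓓(X, ℂ) →L[ℂ] ℂ

/-- A continuous linear operator `T` on a (locally convex) space `E` is *power bounded* if for
every continuous seminorm `p` there is a continuous seminorm `q` with `p (T^m x) ≤ q x` for all
`m` and `x`. -/
def PowerBounded {E : Type*} [AddCommGroup E] [Module ℂ E] [TopologicalSpace E]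
    (T : E →L[ℂ] E) : Prop :=
  ∀ p : Seminorm ℂ E, Continuous p → ∃ q : Seminorm ℂ E, Continuous q ∧
    ∀ (m : ℕ) (x : E), p ((T ^ m) x) ≤ q x

/-- `ψ` (a self map of the set `X`) has *stable orbits*. -/
def StableOrbits {E : Type*} [TopologicalSpace E] (X : Set E) (ψ : E → E) : Prop :=
  ∀ K ⊆ X, IsCompact K → ∃ L ⊆ X, IsCompact L ∧ ∀ m : ℕ, ψ^[m] '' K ⊆ L

/-- `‖f‖_{n,K} = sup {|∂^α f (x)| ; |α| ≤ n, x ∈ K}`, as a value in `[0, ∞]`. The partial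
derivatives of order `k` are the values of the `k`-th derivative on `k`-tuples of standard unit
vectors. -/
noncomputable def cnNorm {d : ℕ} (n : ℕ) (K : Set (Euc d)) (f : Euc d → ℝ) : ℝ≥0∞ :=
  ⨆ x ∈ K, ⨆ k ∈ Set.Iic n, ⨆ s : Fin k → Fin d,
    ‖iteratedFDeriv ℝ k f x (fun j => EuclideanSpace.single (s j) (1 : ℝ))‖ₑ

/-- A smooth bijective symbol on `X` with nowhere vanishing Jacobian determinant. -/
structure IsSymbol {d : ℕ} (X : Opens (Euc d)) (ψ : Euc d → Euc d) : Prop where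
  smooth : ContDiffOn ℝ ∞ ψ X
  bij : BijOn ψ X X
  det_ne : ∀ x ∈ X, (fderiv ℝ ψ x).det ≠ 0

/-- The inverse of `ψ : X → X` (only its values on `X` matter). -/
noncomputable def invSymbol {d : ℕ} (X : Opens (Euc d)) (ψ : Euc d → Euc d) : Euc d → Euc d :=
  Function.invFunOn ψ X

section Aux

variable {d : ℕ} {X : Opens (Euc d)} {ψ : Euc d → Euc d}

theorem IsSymbol.apply_inv (h : IsSymbol X ψ) {y : Euc d} (hy : y ∈ X) :
    ψ (invSymbol X ψ y) = y :=
  h.bij.surjOn.rightInvOn_invFunOn hy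

theorem IsSymbol.inv_mem (h : IsSymbol X ψ) {y : Euc d} (hy : y ∈ X) : invSymbol X ψ y ∈ X :=
  h.bij.surjOn.mapsTo_invFunOn hy

theorem IsSymbol.inv_apply (h : IsSymbol X ψ) {x : Euc d} (hx : x ∈ X) :
    invSymbol X ψ (ψ x) = x :=
  h.bij.injOn.leftInvOn_invFunOn hx

theorem IsSymbol.contDiffAt (h : IsSymbol X ψ) {x : Euc d} (hx : x ∈ X) :
    ContDiffAt ℝ ∞ ψ x :=
  h.smooth.contDiffAt (X.isOpen.mem_nhds hx)

theorem IsSymbol.contDiffOn_inv (h : IsSymbol X ψ) : ContDiffOn ℝ ∞ (invSymbol X ψ) X := by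
  intro y hy
  apply ContDiffAt.contDiffWithinAt
  have hx := h.inv_mem hy
  have hyx := h.apply_inv hy
  set x := invSymbol X ψ y with hxdef
  have hs := h.contDiffAt hx
  have hd : HasFDerivAt ψ
      (((fderiv ℝ ψ x).toContinuousLinearEquivOfDetNeZero (h.det_ne x hx) :
        Euc d ≃L[ℝ] Euc d) : Euc d →L[ℝ] Euc d) x := by
    exact (hs.differentiableAt (by simp)).hasFDerivAt
  have hg := hs.to_localInverse hd (by simp)
  rw [hyx] at hg
  refine hg.congr_of_eventuallyEq ?_
  have hst := hs.hasStrictFDerivAt' hd (by simp)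
  have h1 : ∀ᶠ z in 𝓝 x, invSymbol X ψ (ψ z) = z := by
    filter_upwards [X.isOpen.mem_nhds hx] with z hz using h.inv_apply hz
  have h2 := hst.localInverse_unique h1
  rw [hyx] at h2
  exact h2

theorem contDiff_det : ContDiff ℝ ∞ (fun L : Euc d →L[ℝ] Euc d => L.det) := by
  have : (fun L : Euc d →L[ℝ] Euc d => L.det) = fun L =>
      ∑ σ : Equiv.Perm (Fin d), ((Equiv.Perm.sign σ : ℤ) : ℝ) *
        ∏ i, (L (EuclideanSpace.single i (1 : ℝ))) (σ i) := by
    funext L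
    have h1 : L.det = LinearMap.det (L : Euc d →ₗ[ℝ] Euc d) := rfl
    rw [h1, ← LinearMap.det_toMatrix (EuclideanSpace.basisFun (Fin d) ℝ).toBasis,
      Matrix.det_apply']
    simp [LinearMap.toMatrix_apply]
  rw [this]
  refine ContDiff.sum fun σ _ => contDiff_const.mul (contDiff_prod fun i _ => ?_)
  exact (EuclideanSpace.proj (𝕜 := ℝ) (σ i)).contDiff.comp
    (contDiff_id.clm_apply contDiff_const)

/-- The density `1 / |det Jψ|`, composed with `ψ⁻¹`. -/
noncomputable def weight (X : Opens (Euc d)) (ψ : Euc d → Euc d) (y : Euc d) : ℝ :=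
  |(fderiv ℝ ψ (invSymbol X ψ y)).det|⁻¹

theorem IsSymbol.contDiffOn_weight (h : IsSymbol X ψ) : ContDiffOn ℝ ∞ (weight X ψ) X := by
  have h1 : ContDiffOn ℝ ∞ (fun x => (fderiv ℝ ψ x).det) X :=
    contDiff_det.comp_contDiffOn (h.smooth.fderiv_of_isOpen X.isOpen (by simp))
  have h2 : ContDiffOn ℝ ∞ (fun y => (fderiv ℝ ψ (invSymbol X ψ y)).det) X :=
    h1.comp h.contDiffOn_inv fun y hy => h.inv_mem hy
  intro y hy
  have hne := h.det_ne _ (h.inv_mem hy)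
  have h3 : ContDiffWithinAt ℝ ∞ (fun y => |(fderiv ℝ ψ (invSymbol X ψ y)).det|) X y :=
    ContDiffAt.comp_contDiffWithinAt (g := fun t : ℝ => |t|) y (contDiffAt_abs hne) (h2 y hy)
  exact h3.inv (abs_ne_zero.2 hne)

/-- The function `(φ / |det Jψ|) ∘ ψ⁻¹` on `X`, extended by zero. -/
noncomputable def pushFun (X : Opens (Euc d)) (ψ : Euc d → Euc d) (φ : Euc d → ℂ) :
    Euc d → ℂ :=
  (X : Set (Euc d)).indicator fun y => weight X ψ y • φ (invSymbol X ψ y)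

theorem pushFun_of_mem {φ : Euc d → ℂ} {y : Euc d} (hy : y ∈ X) :
    pushFun X ψ φ y = weight X ψ y • φ (invSymbol X ψ y) :=
  Set.indicator_of_mem (s := (X : Set (Euc d))) hy _

theorem IsSymbol.isCompact_image (h : IsSymbol X ψ) {K : Set (Euc d)} (hK : IsCompact K)
    (hKX : K ⊆ X) : IsCompact (ψ '' K) :=
  hK.image_of_continuousOn (h.smooth.continuousOn.mono hKX)

theorem IsSymbol.image_subset (h : IsSymbol X ψ) {K : Set (Euc d)} (hKX : K ⊆ X) :
    ψ '' K ⊆ X :=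
  (Set.image_mono hKX).trans h.bij.image_eq.subset

theorem IsSymbol.support_pushFun (h : IsSymbol X ψ) {K : Set (Euc d)} {φ : Euc d → ℂ}
    (hφ : Function.support φ ⊆ K) : Function.support (pushFun X ψ φ) ⊆ ψ '' K := by
  intro y hy
  by_cases hyX : y ∈ X
  · rw [Function.mem_support, pushFun_of_mem hyX] at hy
    exact ⟨_, hφ (right_ne_zero_of_smul hy), h.apply_inv hyX⟩
  · exact absurd (Set.indicator_of_notMem (s := (X : Set (Euc d))) hyX _) hy

theorem IsSymbol.contDiffOn_smul (h : IsSymbol X ψ) {φ : Euc d → ℂ} (hφ : ContDiff ℝ ∞ φ) :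
    ContDiffOn ℝ ∞ (fun y => weight X ψ y • (φ ∘ invSymbol X ψ) y) X :=
  h.contDiffOn_weight.smul (hφ.comp_contDiffOn h.contDiffOn_inv)

theorem IsSymbol.contDiff_pushFun (h : IsSymbol X ψ) {K : Set (Euc d)} (hK : IsCompact K)
    (hKX : K ⊆ X) {φ : Euc d → ℂ} (hφ : ContDiff ℝ ∞ φ) (hs : Function.support φ ⊆ K) :
    ContDiff ℝ ∞ (pushFun X ψ φ) := by
  rw [contDiff_iff_contDiffAt]
  intro y
  by_cases hy : y ∈ X
  · refine ((h.contDiffOn_smul hφ).contDiffAt (X.isOpen.mem_nhds hy)).congr_of_eventuallyEq ?_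
    filter_upwards [X.isOpen.mem_nhds hy] with z hz using pushFun_of_mem hz
  · have hy' : (ψ '' K)ᶜ ∈ 𝓝 y :=
      (h.isCompact_image hK hKX).isClosed.isOpen_compl.mem_nhds
        fun hy' => hy (h.image_subset hKX hy')
    refine (contDiffAt_const (c := (0 : ℂ))).congr_of_eventuallyEq ?_
    filter_upwards [hy'] with z hz
    by_contra hne
    exact hz (h.support_pushFun hs hne)

/-- Uniform bounds for the derivatives of order at most `i` of a smooth function on a compact
set. -/
theorem exists_bound {F : Type*} [NormedAddCommGroup F] [NormedSpace ℝ F] {g : Euc d → F}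
    (hg : ContDiffOn ℝ ∞ g X) {K : Set (Euc d)} (hK : IsCompact K) (hKX : K ⊆ X) (i : ℕ) :
    ∃ C : ℝ, 1 ≤ C ∧ ∀ j ≤ i, ∀ x ∈ K, ‖iteratedFDerivWithin ℝ j g X x‖ ≤ C := by
  have key : ∀ j : ℕ, ∃ C : ℝ, ∀ x ∈ K, ‖iteratedFDerivWithin ℝ j g X x‖ ≤ C := fun j =>
    hK.exists_bound_of_continuousOn
      ((hg.continuousOn_iteratedFDerivWithin (by exact_mod_cast le_top)
        X.isOpen.uniqueDiffOn).mono hKX)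
  choose C hC using key
  refine ⟨1 + ∑ j ∈ Finset.range (i + 1), |C j|, ?_, fun j hj x hx => ?_⟩
  · have : 0 ≤ ∑ j ∈ Finset.range (i + 1), |C j| := Finset.sum_nonneg fun _ _ => abs_nonneg _
    linarith
  · have h1 : |C j| ≤ ∑ j ∈ Finset.range (i + 1), |C j| :=
      Finset.single_le_sum (f := fun j => |C j|) (fun _ _ => abs_nonneg _)
        (Finset.mem_range.2 (by omega))
    linarith [hC j x hx, le_abs_self (C j)]

theorem IsSymbol.exists_push_bound (h : IsSymbol X ψ) (K : Compacts (Euc d))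
    (hKX : (K : Set (Euc d)) ⊆ X) (i : ℕ) :
    ∃ (s : Finset ℕ) (C : ℝ), 0 ≤ C ∧ ∀ φ : 𝓓_{K}(Euc d, ℂ), ∀ y ∈ ψ '' (K : Set (Euc d)),
      ‖iteratedFDeriv ℝ i (pushFun X ψ φ) y‖ ≤
        C * (s.sup fun j => ContDiffMapSupportedIn.seminorm ℂ (Euc d) ℂ ⊤ K j) φ := by
  have hcomp := h.isCompact_image K.isCompact hKX
  have hsub := h.image_subset hKX
  obtain ⟨A, hA1, hA⟩ := exists_bound h.contDiffOn_weight hcomp hsub i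
  obtain ⟨D, hD1, hD⟩ := exists_bound h.contDiffOn_inv hcomp hsub i
  refine ⟨Finset.range (i + 1), ∑ j ∈ Finset.range (i + 1),
    (i.choose j : ℝ) * A * ((i - j).factorial * D ^ (i - j)), ?_, fun φ y hy => ?_⟩
  · exact Finset.sum_nonneg fun j _ => by positivity
  set S : ℝ := ((Finset.range (i + 1)).sup
    fun j => ContDiffMapSupportedIn.seminorm ℂ (Euc d) ℂ ⊤ K j) φ with hS
  have hyX : y ∈ (X : Set (Euc d)) := hsub hy
  have hφ : ContDiff ℝ ∞ (φ : Euc d → ℂ) := φ.contDiff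
  have hS0 : 0 ≤ S := apply_nonneg _ _
  have hφS : ∀ j ≤ i, ∀ x, ‖iteratedFDeriv ℝ j φ x‖ ≤ S := by
    intro j hj x
    refine (ContDiffMapSupportedIn.norm_iteratedFDeriv_apply_le_seminorm_top ℂ).trans ?_
    have hle := Finset.le_sup (f := fun j => ContDiffMapSupportedIn.seminorm ℂ (Euc d) ℂ ⊤ K j)
      (Finset.mem_range.2 (Nat.lt_succ_of_le hj))
    exact hle φ
  have heq : iteratedFDeriv ℝ i (pushFun X ψ φ) y =
      iteratedFDerivWithin ℝ i (fun y => weight X ψ y • (φ ∘ invSymbol X ψ) y) X y := by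
    rw [← iteratedFDerivWithin_of_isOpen i X.isOpen hyX]
    exact iteratedFDerivWithin_congr (fun z hz => pushFun_of_mem hz) hyX i
  rw [heq, Finset.sum_mul]
  refine (norm_iteratedFDerivWithin_smul_le (N := ∞) h.contDiffOn_weight
    (hφ.comp_contDiffOn h.contDiffOn_inv) X.isOpen.uniqueDiffOn hyX
    (by exact_mod_cast le_top)).trans (Finset.sum_le_sum fun j hj => ?_)
  have hji : j ≤ i := Nat.lt_succ_iff.1 (Finset.mem_range.1 hj)
  have hc : ‖iteratedFDerivWithin ℝ (i - j) (φ ∘ invSymbol X ψ) X y‖ ≤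
      (i - j).factorial * S * D ^ (i - j) := by
    refine norm_iteratedFDerivWithin_comp_le (N := ∞) (t := univ) hφ.contDiffOn
      h.contDiffOn_inv (WithTop.coe_le_coe.2 le_top) uniqueDiffOn_univ X.isOpen.uniqueDiffOn
      (mapsTo_univ _ _) hyX (fun k hk => ?_) (fun k hk1 hk => ?_)
    · rw [iteratedFDerivWithin_univ]
      exact hφS k (by omega) _
    · exact (hD k (by omega) y hy).trans (le_self_pow₀ hD1 (by omega))
  calc (i.choose j : ℝ) * ‖iteratedFDerivWithin ℝ j (weight X ψ) X y‖ *
        ‖iteratedFDerivWithin ℝ (i - j) (φ ∘ invSymbol X ψ) X y‖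
      ≤ (i.choose j : ℝ) * A * ((i - j).factorial * S * D ^ (i - j)) := by
        gcongr
        exact hA j hji y hy
    _ = (i.choose j : ℝ) * A * ((i - j).factorial * D ^ (i - j)) * S := by ring

end Aux

section Operator

variable {d : ℕ} {X : Opens (Euc d)} {ψ : Euc d → Euc d}

/-- `φ ↦ (φ / |det Jψ|) ∘ ψ⁻¹` from `𝓓(K)` to `𝓓(ψ(K))`. -/
noncomputable def pushSupported (h : IsSymbol X ψ) (K : Compacts (Euc d))
    (hKX : (K : Set (Euc d)) ⊆ X) :
    𝓓_{K}(Euc d, ℂ) →L[ℂ]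
      𝓓_{(⟨ψ '' K, h.isCompact_image K.isCompact hKX⟩ : Compacts (Euc d))}(Euc d, ℂ) :=
  ContDiffMapSupportedIn.mkCLM ℂ (fun φ => pushFun X ψ φ)
    (fun f g x => by
      by_cases hx : x ∈ X
      · simp [pushFun_of_mem hx]
      · simp [pushFun, hx])
    (fun c f x => by
      by_cases hx : x ∈ X
      · simp [pushFun_of_mem hx, mul_left_comm]
      · simp [pushFun, hx])
    (fun f => h.contDiff_pushFun K.isCompact hKX f.contDiff f.support_subset)
    (fun f y hy => by
      by_contra hne
      exact hy (h.support_pushFun f.support_subset hne))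
    (fun i _ => h.exists_push_bound K hKX i)

/-- The continuous operator `φ ↦ (φ / |det Jψ|) ∘ ψ⁻¹` on the space of test functions `𝓓(X)`. -/
noncomputable def pushTest (h : IsSymbol X ψ) : 𝓓(X, ℂ) →L[ℂ] 𝓓(X, ℂ) :=
  TestFunction.limitCLM ℂ
    (fun φ => ⟨pushFun X ψ φ,
      h.contDiff_pushFun φ.hasCompactSupport φ.tsupport_subset φ.contDiff (subset_tsupport _),
      HasCompactSupport.of_support_subset_isCompact
        (h.isCompact_image φ.hasCompactSupport φ.tsupport_subset)
        (h.support_pushFun (subset_tsupport _)),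
      (closure_minimal (h.support_pushFun (subset_tsupport _))
        (h.isCompact_image φ.hasCompactSupport φ.tsupport_subset).isClosed).trans
        (h.image_subset φ.tsupport_subset)⟩)
    (fun K hKX => TestFunction.ofSupportedInCLM ℂ (h.image_subset hKX) ∘L
      pushSupported h K hKX)
    (fun _ _ _ => rfl)

theorem pushTest_apply (h : IsSymbol X ψ) (φ : 𝓓(X, ℂ)) (y : Euc d) :
    pushTest h φ y = pushFun X ψ φ y := rfl

/-- The composition operator `C_ψ` on `𝓓'(X)` for a smooth bijective symbol `ψ` with nowhere
vanishing Jacobian determinant: `⟨C_ψ u, φ⟩ = ⟨u, (φ / |det Jψ|) ∘ ψ⁻¹⟩`. By `compOp_ofFun` below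
it is the continuous extension to `𝓓'(X)` of `f ↦ f ∘ ψ` on `C(X)`. -/
noncomputable def compOp (h : IsSymbol X ψ) : Distr X →L[ℂ] Distr X :=
  ContinuousLinearMap.precomp ℂ (pushTest h)

theorem compOp_apply (h : IsSymbol X ψ) (u : Distr X) (φ : 𝓓(X, ℂ)) :
    compOp h u φ = u (pushTest h φ) := rfl

/-- The distribution `φ ↦ ∫ φ f` defined by a locally integrable function `f` on `X`. -/
noncomputable def ofFun (X : Opens (Euc d)) (f : Euc d → ℂ) : Distr X :=
  TestFunction.integralAgainstBilinCLM (ContinuousLinearMap.mul ℂ ℂ) volume f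

theorem ofFun_apply {f : Euc d → ℂ} (hf : ContinuousOn f X) (φ : 𝓓(X, ℂ)) :
    ofFun X f φ = ∫ x in (X : Set (Euc d)), φ x * f x := by
  have hl : LocallyIntegrableOn f X (volume : Measure (Euc d)) :=
    hf.locallyIntegrableOn X.isOpen.measurableSet
  rw [ofFun, TestFunction.integralAgainstBilinCLM_eq_integral hl,
    setIntegral_eq_integral_of_forall_compl_eq_zero]
  · rfl
  · intro x hx
    have : φ x = 0 := image_eq_zero_of_notMem_tsupport fun hx' => hx (φ.tsupport_subset hx')
    simp [this]

/-- `C_ψ` extends the composition operator on continuous functions. -/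
theorem compOp_ofFun (h : IsSymbol X ψ) {f : Euc d → ℂ} (hf : ContinuousOn f X) :
    compOp h (ofFun X f) = ofFun X (f ∘ ψ) := by
  ext φ
  rw [compOp_apply, ofFun_apply hf,
    ofFun_apply (hf.comp h.smooth.continuousOn h.bij.mapsTo)]
  have key := integral_image_eq_integral_abs_det_fderiv_smul volume X.isOpen.measurableSet
    (fun x hx => ((h.contDiffAt hx).differentiableAt (by simp)).hasFDerivAt.hasFDerivWithinAt)
    h.bij.injOn (fun y => pushTest h φ y * f y)
  rw [h.bij.image_eq] at key
  rw [key]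
  refine setIntegral_congr_fun X.isOpen.measurableSet fun x hx => ?_
  have hd : |(fderiv ℝ ψ x).det| ≠ 0 := abs_ne_zero.2 (h.det_ne x hx)
  have hp : pushTest h φ (ψ x) = |(fderiv ℝ ψ x).det|⁻¹ • φ x := by
    rw [pushTest_apply, pushFun_of_mem (h.bij.mapsTo hx), weight, h.inv_apply hx]
  simp only [hp, Function.comp_apply]
  rw [← smul_mul_assoc, smul_smul, mul_inv_cancel₀ hd, one_smul]

end Operator

end CompositionOp

/-! Let T be `pushTest`, the transpose of `compOp`. It transports a test function as a density: T^m
φ (ψ^m x) = φ(x) / |det Jψ^m(x)|. Both implications are statements about the orbits of T on test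
functions.

Sufficiency. Stable orbits keep the supports of all T^m φ, φ ∈ 𝓓(K), in one compact set. Since the
density factor of T^m is |det J(ψ^{-m})|, bounds on the derivatives of ψ^{-m} on ψ^m(K) control
every derivative of T^m φ uniformly in m. So the powers of T are equicontinuous
(`exists_seminorm_pushTest_pow`) and send a bounded set into a single bounded set; for the strong
dual this is power boundedness.

Necessity. For fixed φ, power boundedness dominates u ↦ |u(T^m φ)| by the supremum of |u| over one
bounded set, up to a constant and for all m. Taking for u a derivative at a point bounds all
derivatives of T^m φ (`PowerBounded.exists_deriv_bound`). Taking for u a locally finite sum of point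
masses confines the supports to a compact set when φ ≥ 0 (`PowerBounded.exists_support_subset`), and
a cutoff φ then gives stable orbits. For the inverse iterates, let φ be a cutoff equal to 1 on K.
Near ψ^m(K) the c-th component of ψ^{-m} is T^m(x_c φ) / T^m φ, so only a lower bound for the
denominator is missing, that is, for 1/|det Jψ^m| on K. It comes from recurrence
(`PowerBounded.exists_recurrence`): the orbit of φ is relatively compact for uniform convergence and
T preserves the L¹ norm, so T^n φ returns close to φ for arbitrarily large n. At such a time the
density is at least 1/2, and the chain rule through ψ^m, with the upper bound for the remaining n -
m steps, bounds the density at time m from below. -/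

namespace CompositionOp

/-! ### Seminorms and bounded sets in the space of test functions -/

section TestFunctionSpace

variable {d : ℕ} {X : Opens (Euc d)}

/-- Scalar multiplication by a fixed complex number, as a continuous operator on `𝓓(X)`. -/
noncomputable def testSMul (X : Opens (Euc d)) (c : ℂ) : 𝓓(X, ℂ) →L[ℂ] 𝓓(X, ℂ) :=
  TestFunction.mkCLM ℂ (fun φ => c • φ) (fun _ _ => smul_add _ _ _)
    (fun _ _ => smul_comm _ _ _) fun _ hK =>
      (TestFunction.continuous_ofSupportedIn hK).comp (continuous_const_smul c)

theorem testSMul_apply (c : ℂ) (φ : 𝓓(X, ℂ)) : testSMul X c φ = c • φ := rfl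

/-- Joint continuity is reduced to that of real scalar multiplication by splitting the scalar into
real and imaginary parts; multiplication by i is a fixed continuous operator. -/
instance continuousSMul_testFunction : ContinuousSMul ℂ 𝓓(X, ℂ) := by
  refine ⟨?_⟩
  have h : (fun p : ℂ × 𝓓(X, ℂ) => p.1 • p.2) =
      fun p => p.1.re • p.2 + p.1.im • testSMul X Complex.I p.2 := by
    funext p
    ext x
    simp only [testSMul_apply, add_apply, smul_apply]
    conv_lhs => rw [← Complex.re_add_im p.1]
    simp only [Complex.real_smul, smul_eq_mul]
    ring
  rw [h]
  have h1 : Continuous fun p : ℂ × 𝓓(X, ℂ) => testSMul X Complex.I p.2 :=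
    (testSMul X Complex.I).continuous.comp continuous_snd
  exact ((Complex.continuous_re.comp continuous_fst).smul continuous_snd).add
    ((Complex.continuous_im.comp continuous_fst).smul h1)

/-- The topology defined by a single seminorm: it is locally convex, the seminorm is continuous, and
a map into it is continuous if it is so with respect to the seminorm. -/
theorem exists_topology_of_seminorm {V : Type*} [AddCommGroup V] [Module ℝ V]
    (R : Seminorm ℝ V) : ∃ t : TopologicalSpace V, @IsTopologicalAddGroup V t _ ∧
      @ContinuousSMul ℝ V _ _ t ∧ @LocallyConvexSpace ℝ V _ _ _ _ t ∧
      @Continuous V ℝ t _ R ∧ ∀ (Y : Type _) [TopologicalSpace Y] (f : Y → V),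
        (∀ y, Tendsto (fun z => R (f z - f y)) (𝓝 y) (𝓝 0)) → @Continuous Y V _ t f := by
  let p : SeminormFamily ℝ V Unit := fun _ => R
  let t : TopologicalSpace V := p.moduleFilterBasis.topology
  have hp : WithSeminorms p := ⟨rfl⟩
  refine ⟨t, hp.topologicalAddGroup, hp.continuousSMul, hp.toLocallyConvexSpace,
    hp.continuous_seminorm (), fun Y _ f hf => continuous_iff_continuousAt.2 fun y =>
      (hp.tendsto_nhds f (f y)).2 fun _ ε hε => (hf y).eventually_lt_const hε⟩

/-- A seminorm on `𝓓(X)` is continuous as soon as its restrictions to all the spaces `𝓓(K)` are. -/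
theorem continuous_seminorm_of_comp_ofSupportedIn (R : Seminorm ℝ 𝓓(X, ℂ))
    (h : ∀ (K : Compacts (Euc d)) (hK : (K : Set (Euc d)) ⊆ X),
      Continuous fun φ : 𝓓_{K}(Euc d, ℂ) => R (TestFunction.ofSupportedIn hK φ)) :
    Continuous R := by
  obtain ⟨t, h1, h2, h3, hR, ht⟩ := exists_topology_of_seminorm R
  -- The LF topology is the finest locally convex one for which the inclusions of the 𝓓(K) are
  -- continuous, so it is enough to test these inclusions against the topology of `R`.
  have hle : TestFunction.topologicalSpace X ℂ ⊤ ≤ t := by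
    rw [@TestFunction.topologicalSpace_le_iff _ _ _ _ _ _ _ _ t h1 h2 h3,
      TestFunction.originalTop]
    refine iSup₂_le fun K hK => ?_
    rw [← continuous_iff_coinduced_le]
    refine ht _ _ fun φ => ?_
    have h5 : Tendsto (fun χ : 𝓓_{K}(Euc d, ℂ) => χ - φ) (𝓝 φ) (𝓝 0) := by
      have h : Tendsto (fun χ : 𝓓_{K}(Euc d, ℂ) => χ - φ) (𝓝 φ) (𝓝 (φ - φ)) :=
        tendsto_id.sub tendsto_const_nhds
      rwa [sub_self] at h
    have h4 := ((h K hK).tendsto 0).comp h5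
    have h6 : R (TestFunction.ofSupportedIn hK (0 : 𝓓_{K}(Euc d, ℂ))) = 0 := map_zero R
    rwa [h6] at h4
  exact continuous_le_dom hle hR

/-- If a family of operators on `𝓓(X)` is equicontinuous, it maps bounded sets to sets that are
bounded uniformly in the parameter. -/
theorem isVonNBounded_iUnion_image {ι : Type*} (T : ι → 𝓓(X, ℂ) →L[ℂ] 𝓓(X, ℂ))
    (hT : ∀ r : Seminorm ℝ 𝓓(X, ℂ), Continuous r →
      ∃ R : Seminorm ℝ 𝓓(X, ℂ), Continuous R ∧ ∀ i φ, r (T i φ) ≤ R φ)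
    {B : Set 𝓓(X, ℂ)} (hB : Bornology.IsVonNBounded ℂ B) :
    Bornology.IsVonNBounded ℂ (⋃ i, T i '' B) := by
  intro V hV
  obtain ⟨⟨s, ε⟩, hε, hsub⟩ :=
    (PolynormableSpace.withSeminorms ℝ 𝓓(X, ℂ)).hasBasis_zero_ball.mem_iff.1 hV
  obtain ⟨R, hR, hTR⟩ := hT (s.sup fun p => p.1)
    (Finset.sup_induction (p := fun q : Seminorm ℝ 𝓓(X, ℂ) => Continuous q) continuous_const (fun _ h₁ _ h₂ => h₁.sup h₂) fun p _ => p.2)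
  have hU : {φ : 𝓓(X, ℂ) | R φ < ε} ∈ 𝓝 0 :=
    (isOpen_lt hR continuous_const).mem_nhds (by simpa using hε)
  filter_upwards [hB hU] with a ha
  rintro _ hx
  obtain ⟨i, φ, hφ, rfl⟩ := mem_iUnion.1 hx
  obtain ⟨χ, hχ, rfl⟩ := ha hφ
  refine ⟨T i χ, hsub ?_, by simp⟩
  rw [Seminorm.mem_ball_zero]
  exact (hTR i χ).trans_lt hχ

end TestFunctionSpace

/-! ### Seminorms of the strong dual and bounded sets of test functions -/

section Dual

variable {d : ℕ} {X : Opens (Euc d)}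

/-- A continuous seminorm on `𝓓'(X)` is dominated by uniform convergence on a bounded set. -/
theorem exists_isVonNBounded_of_continuous {q : Seminorm ℂ (Distr X)} (hq : Continuous q) :
    ∃ B : Set 𝓓(X, ℂ), Bornology.IsVonNBounded ℂ B ∧
      ∀ u : Distr X, (∀ φ ∈ B, ‖u φ‖ ≤ 1) → q u ≤ 1 := by
  have hU : {u : Distr X | q u < 1} ∈ 𝓝 0 :=
    (isOpen_lt hq continuous_const).mem_nhds (by simp)
  obtain ⟨⟨B, ε⟩, ⟨hB, hε⟩, hsub⟩ := (ContinuousLinearMap.hasBasis_nhds_zero_of_basis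
    (E := 𝓓(X, ℂ)) (σ := RingHom.id ℂ) (Metric.nhds_basis_ball (x := (0 : ℂ)))).mem_iff.1 hU
  have hε : 0 < ε := hε
  -- Scaling by 2/ε rather than 1/ε gives ‖u φ‖ ≤ ε/2 on `B`, which puts `u φ` in the open ball.
  refine ⟨testSMul X ((2 / ε : ℝ) : ℂ) '' B, hB.image _, fun u hu => ?_⟩
  refine (hsub (show u ∈ {f : Distr X | ∀ x ∈ B, f x ∈ Metric.ball 0 ε} from
    fun φ hφ => ?_) : q u < 1).le
  have h := hu _ ⟨φ, hφ, rfl⟩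
  rw [testSMul_apply, map_smul, smul_eq_mul, norm_mul, Complex.norm_real,
    Real.norm_of_nonneg (by positivity)] at h
  rw [mem_ball_zero_iff]
  have : ‖u φ‖ = ε / 2 * (2 / ε * ‖u φ‖) := by field_simp
  rw [this]
  nlinarith

/-- The supremum over a bounded subset of `𝓓(X)` is a continuous seminorm on `𝓓'(X)`. -/
theorem exists_continuous_seminorm_of_isVonNBounded {B : Set 𝓓(X, ℂ)}
    (hB : Bornology.IsVonNBounded ℂ B) :
    ∃ q : Seminorm ℂ (Distr X), Continuous q ∧ ∀ u : Distr X, ∀ φ ∈ B, ‖u φ‖ ≤ q u := by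
  let ev (φ : 𝓓(X, ℂ)) : Distr X →ₗ[ℂ] ℂ :=
    { toFun := fun u => u φ, map_add' := fun _ _ => rfl, map_smul' := fun _ _ => rfl }
  let p : B → Seminorm ℂ (Distr X) := fun φ => (normSeminorm ℂ ℂ).comp (ev φ)
  have hp : ∀ φ u, p φ u = ‖u φ‖ := fun _ _ => rfl
  have hU : ∀ᶠ u : Distr X in 𝓝 0, ∀ φ : B, p φ u ≤ 1 := by
    filter_upwards [ContinuousLinearMap.eventually_nhds_zero_mapsTo (σ := RingHom.id ℂ) hB
      (Metric.closedBall_mem_nhds (0 : ℂ) one_pos)] with u hu φ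
    simpa [hp] using hu φ.2
  -- The pointwise supremum is finite because the set where all `p φ` are at most 1 is a
  -- neighbourhood of 0, hence absorbent.
  have bdd : BddAbove (range p) := Seminorm.bddAbove_of_absorbent (absorbent_nhds_zero hU)
    (fun x hx => ⟨1, forall_mem_range.mpr hx⟩)
  refine ⟨⨆ φ, p φ, Seminorm.continuous' (r := 1) ?_, fun u φ hφ => ?_⟩
  · filter_upwards [hU] with x hx
    simpa only [Seminorm.closedBall_iSup bdd _ one_pos, mem_iInter, Seminorm.mem_closedBall_zero]
      using hx
  · rw [Seminorm.iSup_apply bdd, ← hp ⟨φ, hφ⟩ u]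
    exact le_ciSup (f := fun φ => p φ u) (Seminorm.bddAbove_range_iff.1 bdd u) ⟨φ, hφ⟩

end Dual
-- Iterates of the symbol and powers of the push-forward
section Iterate

variable {d : ℕ} {X : Opens (Euc d)} {ψ χ : Euc d → Euc d}

theorem IsSymbol.differentiableAt (h : IsSymbol X ψ) {x : Euc d} (hx : x ∈ X) :
    DifferentiableAt ℝ ψ x :=
  (h.contDiffAt hx).differentiableAt (by simp)

theorem IsSymbol.det_fderiv_comp (h : IsSymbol X ψ) (h' : IsSymbol X χ) {x : Euc d} (hx : x ∈ X) :
    (fderiv ℝ (χ ∘ ψ) x).det = (fderiv ℝ χ (ψ x)).det * (fderiv ℝ ψ x).det := by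
  rw [fderiv_comp x (h'.differentiableAt (h.bij.mapsTo hx)) (h.differentiableAt hx)]
  exact LinearMap.det_comp _ _

theorem IsSymbol.comp (h' : IsSymbol X χ) (h : IsSymbol X ψ) : IsSymbol X (χ ∘ ψ) where
  smooth := h'.smooth.comp h.smooth h.bij.mapsTo
  bij := h'.bij.comp h.bij
  det_ne x hx := by
    rw [h.det_fderiv_comp h' hx]
    exact mul_ne_zero (h'.det_ne _ (h.bij.mapsTo hx)) (h.det_ne x hx)

theorem isSymbol_id (X : Opens (Euc d)) : IsSymbol X id where
  smooth := contDiffOn_id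
  bij := bijOn_id _
  det_ne x _ := by
    rw [fderiv_id]
    have : (ContinuousLinearMap.id ℝ (Euc d)).det = 1 := LinearMap.det_id
    simp [this]

theorem IsSymbol.iterate (h : IsSymbol X ψ) (m : ℕ) : IsSymbol X ψ^[m] := by
  induction m with
  | zero => exact isSymbol_id X
  | succ m ih => exact ih.comp h

theorem IsSymbol.iterate_inv_apply (h : IsSymbol X ψ) (m : ℕ) {x : Euc d} (hx : x ∈ X) :
    (invSymbol X ψ)^[m] (ψ^[m] x) = x := by
  induction m generalizing x with
  | zero => rfl
  | succ m ih =>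
    rw [Function.iterate_succ_apply', Function.iterate_succ_apply, ih (h.bij.mapsTo hx),
      h.inv_apply hx]

theorem IsSymbol.invSymbol_iterate (h : IsSymbol X ψ) (m : ℕ) {y : Euc d} (hy : y ∈ X) :
    invSymbol X ψ^[m] y = (invSymbol X ψ)^[m] y := by
  conv_rhs => rw [← (h.iterate m).apply_inv hy]
  rw [h.iterate_inv_apply m ((h.iterate m).inv_mem hy)]

/-- The density `1 / |det Jψ|`. -/
noncomputable def invJac (ψ : Euc d → Euc d) (x : Euc d) : ℝ := |(fderiv ℝ ψ x).det|⁻¹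

theorem IsSymbol.invJac_pos (h : IsSymbol X ψ) {x : Euc d} (hx : x ∈ X) : 0 < invJac ψ x :=
  inv_pos.2 (abs_pos.2 (h.det_ne x hx))

theorem IsSymbol.invJac_comp (h : IsSymbol X ψ) (h' : IsSymbol X χ) {x : Euc d} (hx : x ∈ X) :
    invJac (χ ∘ ψ) x = invJac χ (ψ x) * invJac ψ x := by
  rw [invJac, h.det_fderiv_comp h' hx, abs_mul, mul_inv]
  rfl

theorem IsSymbol.pushFun_apply (h : IsSymbol X ψ) (φ : Euc d → ℂ) {x : Euc d} (hx : x ∈ X) :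
    pushFun X ψ φ (ψ x) = invJac ψ x • φ x := by
  rw [pushFun_of_mem (h.bij.mapsTo hx), weight, h.inv_apply hx]
  rfl

theorem pushFun_of_notMem {φ : Euc d → ℂ} {y : Euc d} (hy : y ∉ X) : pushFun X ψ φ y = 0 :=
  Set.indicator_of_notMem (s := (X : Set (Euc d))) hy _

theorem IsSymbol.pushFun_comp (h : IsSymbol X ψ) (h' : IsSymbol X χ) (φ : Euc d → ℂ) :
    pushFun X (χ ∘ ψ) φ = pushFun X χ (pushFun X ψ φ) := by
  funext y
  by_cases hy : y ∈ X
  · obtain ⟨x, hx, rfl⟩ := (h'.comp h).bij.surjOn hy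
    rw [(h'.comp h).pushFun_apply φ hx, Function.comp_apply,
      h'.pushFun_apply _ (h.bij.mapsTo hx), h.pushFun_apply φ hx, h.invJac_comp h' hx, mul_smul]
  · rw [pushFun_of_notMem hy, pushFun_of_notMem hy]

theorem pushTest_pow_apply (h : IsSymbol X ψ) (m : ℕ) (φ : 𝓓(X, ℂ)) :
    ((pushTest h ^ m) φ : Euc d → ℂ) = pushFun X ψ^[m] φ := by
  induction m with
  | zero =>
    funext y
    by_cases hy : y ∈ X
    · have := (isSymbol_id X).pushFun_apply (φ : Euc d → ℂ) hy
      have hd : (ContinuousLinearMap.id ℝ (Euc d)).det = 1 := LinearMap.det_id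
      simpa [invJac, hd] using this.symm
    · rw [Function.iterate_zero, pushFun_of_notMem hy]
      exact image_eq_zero_of_notMem_tsupport fun h' => hy (φ.tsupport_subset h')
  | succ m ih =>
    rw [Function.iterate_succ', (h.iterate m).pushFun_comp h, ← ih, pow_succ']
    rfl

theorem pushTest_pow_apply_iterate (h : IsSymbol X ψ) (m : ℕ) (φ : 𝓓(X, ℂ)) {x : Euc d}
    (hx : x ∈ X) : (pushTest h ^ m) φ (ψ^[m] x) = invJac ψ^[m] x • φ x := by
  rw [pushTest_pow_apply]
  exact (h.iterate m).pushFun_apply φ hx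

theorem pushTest_pow_of_notMem (h : IsSymbol X ψ) (m : ℕ) (φ : 𝓓(X, ℂ)) {y : Euc d}
    (hy : y ∉ X) : (pushTest h ^ m) φ y = 0 := by
  rw [pushTest_pow_apply, pushFun_of_notMem hy]

set_option synthInstance.maxHeartbeats 400000 in
theorem compOp_pow_apply (h : IsSymbol X ψ) (m : ℕ) (u : Distr X) (φ : 𝓓(X, ℂ)) :
    (compOp h ^ m) u φ = u ((pushTest h ^ m) φ) := by
  induction m generalizing u with
  | zero => rfl
  | succ m ih =>
    rw [pow_succ, pow_succ']
    exact ih (compOp h u)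

/-- In the change of variables y = ψ(x) the density factor cancels the Jacobian. This L¹ isometry
drives the recurrence argument. -/
theorem IsSymbol.integral_norm_pushFun (h : IsSymbol X ψ) (φ : 𝓓(X, ℂ)) :
    ∫ y, ‖pushFun X ψ φ y‖ = ∫ x, ‖φ x‖ := by
  have h0 : ∀ y ∉ (X : Set (Euc d)), ‖pushFun X ψ φ y‖ = 0 := fun y hy => by
    rw [pushFun_of_notMem hy, norm_zero]
  have h1 : ∀ y ∉ (X : Set (Euc d)), ‖φ y‖ = 0 := fun y hy => by
    rw [image_eq_zero_of_notMem_tsupport fun h' => hy (φ.tsupport_subset h'), norm_zero]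
  rw [← setIntegral_eq_integral_of_forall_compl_eq_zero h0,
    ← setIntegral_eq_integral_of_forall_compl_eq_zero h1]
  have key := integral_image_eq_integral_abs_det_fderiv_smul volume X.isOpen.measurableSet
    (fun x hx => (h.differentiableAt hx).hasFDerivAt.hasFDerivWithinAt)
    h.bij.injOn (fun y => ‖pushFun X ψ φ y‖)
  rw [h.bij.image_eq] at key
  rw [key]
  refine setIntegral_congr_fun X.isOpen.measurableSet fun x hx => ?_
  have hd : |(fderiv ℝ ψ x).det| ≠ 0 := abs_ne_zero.2 (h.det_ne x hx)
  simp only [h.pushFun_apply φ hx, norm_smul, Real.norm_of_nonneg (h.invJac_pos hx).le, smul_eq_mul]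
  rw [invJac, mul_inv_cancel_left₀ hd]

theorem integral_norm_pushTest_pow (h : IsSymbol X ψ) (m : ℕ) (φ : 𝓓(X, ℂ)) :
    ∫ y, ‖(pushTest h ^ m) φ y‖ = ∫ x, ‖φ x‖ := by
  rw [pushTest_pow_apply, (h.iterate m).integral_norm_pushFun]

end Iterate

/-! ### Uniform derivative bounds for compositions, components and densities -/

section Bounds

variable {d : ℕ} {X : Opens (Euc d)} {ψ χ : Euc d → Euc d}

/-- Uniform bounds for the derivatives of order at most `n` of a smooth function on a compact
subset of an open subset of a normed space. -/
theorem exists_bound_of_isCompact {V F : Type*} [NormedAddCommGroup V] [NormedSpace ℝ V]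
    [NormedAddCommGroup F] [NormedSpace ℝ F] {U K : Set V} {g : V → F} (hU : IsOpen U)
    (hg : ContDiffOn ℝ ∞ g U) (hK : IsCompact K) (hKU : K ⊆ U) (n : ℕ) :
    ∃ C : ℝ, 0 ≤ C ∧ ∀ j ≤ n, ∀ x ∈ K, ‖iteratedFDerivWithin ℝ j g U x‖ ≤ C := by
  have key : ∀ j : ℕ, ∃ C : ℝ, ∀ x ∈ K, ‖iteratedFDerivWithin ℝ j g U x‖ ≤ C := fun j =>
    hK.exists_bound_of_continuousOn
      ((hg.continuousOn_iteratedFDerivWithin (by exact_mod_cast le_top)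
        hU.uniqueDiffOn).mono hKU)
  choose C hC using key
  refine ⟨∑ j ∈ Finset.range (n + 1), |C j|, Finset.sum_nonneg fun _ _ => abs_nonneg _,
    fun j hj x hx => ?_⟩
  have h1 : |C j| ≤ ∑ j ∈ Finset.range (n + 1), |C j| :=
    Finset.single_le_sum (f := fun j => |C j|) (fun _ _ => abs_nonneg _)
      (Finset.mem_range.2 (by omega))
  linarith [hC j x hx, le_abs_self (C j)]

/-- The derivatives of `g ∘ f` at a point are bounded in terms of those of `f`, uniformly in `f`,
as long as the value of `f` stays in a compact set. -/
theorem exists_bound_comp {E V F : Type*} [NormedAddCommGroup E] [NormedSpace ℝ E]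
    [NormedAddCommGroup V] [NormedSpace ℝ V]
    [NormedAddCommGroup F] [NormedSpace ℝ F] {U K : Set V} {g : V → F} (hU : IsOpen U)
    (hg : ContDiffOn ℝ ∞ g U) (hK : IsCompact K) (hKU : K ⊆ U) (n : ℕ) (D : ℝ) :
    ∃ B : ℝ, 0 ≤ B ∧ ∀ (S : Set E) (f : E → V), IsOpen S → ContDiffOn ℝ ∞ f S → MapsTo f S U →
      ∀ y ∈ S, f y ∈ K → (∀ k ≤ n, ‖iteratedFDerivWithin ℝ k f S y‖ ≤ D) →
        ∀ k ≤ n, ‖iteratedFDerivWithin ℝ k (g ∘ f) S y‖ ≤ B := by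
  obtain ⟨C, hC0, hC⟩ := exists_bound_of_isCompact hU hg hK hKU n
  -- The composition estimate wants bounds of the form `D ^ i` for i ≥ 1; replacing `D` by `max 1 D`
  -- makes the uniform bound imply these.
  refine ⟨n.factorial * C * (max 1 D) ^ n, by positivity,
    fun S f hS hf hSU y hy hyK hD k hk => ?_⟩
  have h1 : ‖iteratedFDerivWithin ℝ k (g ∘ f) S y‖ ≤ k.factorial * C * (max 1 D) ^ k := by
    refine norm_iteratedFDerivWithin_comp_le (N := ∞) hg hf (WithTop.coe_le_coe.2 le_top)
      hU.uniqueDiffOn hS.uniqueDiffOn hSU hy (fun i hi => hC i (hi.trans hk) _ hyK)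
      (fun i hi1 hi => ?_)
    exact ((hD i (hi.trans hk)).trans (le_max_right 1 D)).trans
      (le_self_pow₀ (le_max_left 1 D) (by omega))
  refine h1.trans ?_
  gcongr
  · exact le_max_left _ _

theorem norm_multilinear_le_sum {k : ℕ} {F : Type*} [NormedAddCommGroup F] [NormedSpace ℝ F]
    (M : ContinuousMultilinearMap ℝ (fun _ : Fin k => Euc d) F) :
    ‖M‖ ≤ ∑ s : Fin k → Fin d, ‖M fun j => EuclideanSpace.single (s j) (1 : ℝ)‖ := by
  refine M.opNorm_le_bound (Finset.sum_nonneg fun _ _ => norm_nonneg _) fun v => ?_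
  have hv : v = fun j => ∑ i : Fin d, v j i • EuclideanSpace.single i (1 : ℝ) := by
    funext j
    ext i
    simp [Finset.sum_apply, Pi.single_apply]
  conv_lhs => rw [hv]
  rw [M.map_sum (g := fun j i => v j i • EuclideanSpace.single i (1 : ℝ)), Finset.sum_mul]
  refine (norm_sum_le _ _).trans (Finset.sum_le_sum fun s _ => ?_)
  rw [M.map_smul_univ (fun j => v j (s j)), norm_smul, mul_comm, norm_prod]
  gcongr with j
  exact PiLp.norm_apply_le _ _

theorem norm_le_sum_coord (v : Euc d) : ‖v‖ ≤ ∑ c, ‖v c‖ := by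
  have hv : v = ∑ i : Fin d, v i • EuclideanSpace.single i (1 : ℝ) := by
    ext i
    simp [Finset.sum_apply, Pi.single_apply]
  conv_lhs => rw [hv]
  refine (norm_sum_le _ _).trans (Finset.sum_le_sum fun s _ => ?_)
  simp [norm_smul]

theorem norm_iteratedFDeriv_le_sum {k : ℕ} {g : Euc d → Euc d} {y : Euc d}
    (hg : ContDiffAt ℝ ∞ g y) :
    ‖iteratedFDeriv ℝ k g y‖ ≤ ∑ s : Fin k → Fin d, ∑ c : Fin d,
      ‖iteratedFDeriv ℝ k (fun z => g z c) y
        (fun j => EuclideanSpace.single (s j) (1 : ℝ))‖ := by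
  refine (norm_multilinear_le_sum _).trans (Finset.sum_le_sum fun s _ => ?_)
  refine (norm_le_sum_coord _).trans_eq (Finset.sum_congr rfl fun c _ => ?_)
  have h := (EuclideanSpace.proj c : Euc d →L[ℝ] ℝ).iteratedFDeriv_comp_left
    hg (i := k) (by exact_mod_cast le_top)
  have h2 : (EuclideanSpace.proj c : Euc d →L[ℝ] ℝ) ∘ g = fun z => g z c := rfl
  rw [← h2, h]
  rfl

/-- Passage from partial derivatives of components to operator norms: a multilinear map is
controlled by its values on tuples of unit vectors, and a vector by its coordinates. -/
theorem norm_iteratedFDeriv_le_of_iSup_cnNorm_lt_top {ι : Type*} {g : ι → Euc d → Euc d}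
    {K : ι → Set (Euc d)} {n : ℕ} (hg : ∀ m, ∀ y ∈ K m, ContDiffAt ℝ ∞ (g m) y)
    (h : ∀ c : Fin d, (⨆ m, cnNorm n (K m) fun y => g m y c) < ⊤) :
    ∃ D : ℝ, ∀ m, ∀ y ∈ K m, ∀ k ≤ n, ‖iteratedFDeriv ℝ k (g m) y‖ ≤ D := by
  let M : Fin d → ℝ := fun c => (⨆ m, cnNorm n (K m) fun y => g m y c).toReal
  have hM : ∀ c m, ∀ y ∈ K m, ∀ k ≤ n, ∀ s : Fin k → Fin d,
      ‖iteratedFDeriv ℝ k (fun z => g m z c) y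
        (fun j => EuclideanSpace.single (s j) (1 : ℝ))‖ ≤ M c := by
    intro c m y hy k hk s
    rw [← toReal_enorm]
    refine ENNReal.toReal_mono (h c).ne ?_
    refine le_iSup_of_le m (le_iSup₂_of_le y hy (le_iSup₂_of_le k hk ?_))
    exact le_iSup (fun s : Fin k → Fin d => ‖iteratedFDeriv ℝ k (fun z => g m z c) y
        (fun j => EuclideanSpace.single (s j) (1 : ℝ))‖ₑ) s
  refine ⟨∑ k ∈ Finset.range (n + 1), ∑ _s : Fin k → Fin d, ∑ c, M c, fun m y hy k hk => ?_⟩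
  refine (norm_iteratedFDeriv_le_sum (hg m y hy)).trans ((Finset.sum_le_sum fun s _ =>
    Finset.sum_le_sum fun c _ => hM c m y hy k hk s).trans ?_)
  refine Finset.single_le_sum (f := fun k => ∑ _s : Fin k → Fin d, ∑ c, M c)
    (fun k _ => Finset.sum_nonneg fun s _ => Finset.sum_nonneg fun c _ => ENNReal.toReal_nonneg)
    (Finset.mem_range.2 (by omega))

theorem IsSymbol.weight_eq (h : IsSymbol X χ) {y : Euc d} (hy : y ∈ X) :
    weight X χ y = |(fderiv ℝ (invSymbol X χ) y).det| := by
  have hG : DifferentiableAt ℝ (invSymbol X χ) y :=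
    (h.contDiffOn_inv.contDiffAt (X.isOpen.mem_nhds hy)).differentiableAt (by simp)
  have h1 : fderiv ℝ (χ ∘ invSymbol X χ) y = ContinuousLinearMap.id ℝ (Euc d) := by
    rw [← fderiv_id (𝕜 := ℝ) (x := y)]
    refine Filter.EventuallyEq.fderiv_eq ?_
    filter_upwards [X.isOpen.mem_nhds hy] with z hz using h.apply_inv hz
  rw [fderiv_comp y (h.differentiableAt (h.inv_mem hy)) hG] at h1
  have h2 : (fderiv ℝ χ (invSymbol X χ y)).det * (fderiv ℝ (invSymbol X χ) y).det = 1 := by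
    have h3 : (ContinuousLinearMap.id ℝ (Euc d)).det = 1 := LinearMap.det_id
    rw [← h3, ← h1]
    exact (LinearMap.det_comp _ _).symm
  rw [weight]
  refine inv_eq_of_mul_eq_one_right ?_
  rw [← abs_mul, h2, abs_one]

/-- The density is |det| of the derivative of the inverse, and det is a fixed smooth function
evaluated on a ball of radius `D`. Hence `A` depends on `d`, `i` and `D` only and serves all
iterates at once. -/
theorem exists_weight_bound (d i : ℕ) (D : ℝ) : ∃ A : ℝ, 0 ≤ A ∧ ∀ (X : Opens (Euc d))
    (χ : Euc d → Euc d), IsSymbol X χ → ∀ y ∈ X,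
      (∀ k ≤ i + 1, ‖iteratedFDerivWithin ℝ k (invSymbol X χ) X y‖ ≤ D) →
        ∀ k ≤ i, ‖iteratedFDerivWithin ℝ k (weight X χ) X y‖ ≤ A := by
  obtain ⟨A, hA0, hA⟩ := exists_bound_comp (E := Euc d) isOpen_univ
    (contDiff_det (d := d)).contDiffOn (isCompact_closedBall (0 : Euc d →L[ℝ] Euc d) D)
    (subset_univ _) i D
  refine ⟨A, hA0, fun X χ h y hy hD k hk => ?_⟩
  have hfd : ContDiffOn ℝ ∞ (fderiv ℝ (invSymbol X χ)) X :=
    h.contDiffOn_inv.fderiv_of_isOpen X.isOpen (by simp)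
  have hfdeq : ∀ k, ‖iteratedFDerivWithin ℝ k (fderiv ℝ (invSymbol X χ)) X y‖ =
      ‖iteratedFDerivWithin ℝ (k + 1) (invSymbol X χ) X y‖ := fun k => by
    rw [← norm_iteratedFDerivWithin_fderivWithin X.isOpen.uniqueDiffOn hy]
    congr 1
    exact iteratedFDerivWithin_congr (fun z hz => (fderivWithin_of_isOpen X.isOpen hz).symm) hy k
  have hbd := hA X (fderiv ℝ (invSymbol X χ)) X.isOpen hfd (mapsTo_univ _ _) y hy
    (by
      rw [mem_closedBall_zero_iff, ← norm_iteratedFDerivWithin_zero (𝕜 := ℝ) (s := (X : Set (Euc d))),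
        hfdeq]
      exact hD _ (by omega))
    (fun k hk => (hfdeq k).trans_le (hD _ (by omega))) k hk
  have hdet : (fderiv ℝ (invSymbol X χ) y).det ≠ 0 := by
    have := h.weight_eq hy
    have h0 : weight X χ y ≠ 0 := inv_ne_zero (abs_ne_zero.2 (h.det_ne _ (h.inv_mem hy)))
    rw [this] at h0
    exact abs_ne_zero.1 h0
  have hcont : ContinuousAt (fun z => (fderiv ℝ (invSymbol X χ) z).det) y :=
    ((contDiff_det.comp_contDiffOn hfd).continuousOn).continuousAt (X.isOpen.mem_nhds hy)
  rw [iteratedFDerivWithin_of_isOpen k X.isOpen hy] at hbd ⊢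
  -- The absolute value is harmless: the determinant keeps its sign near `y`, so the density is
  -- locally ± the determinant.
  rcases hdet.lt_or_gt with hneg | hpos
  · have he : weight X χ =ᶠ[𝓝 y]
        -((fun L : Euc d →L[ℝ] Euc d => L.det) ∘ fderiv ℝ (invSymbol X χ)) := by
      filter_upwards [hcont.eventually_lt_const hneg, X.isOpen.mem_nhds hy] with z hz hzX
      rw [h.weight_eq hzX, abs_of_neg hz]
      rfl
    rw [(he.iteratedFDeriv ℝ k).eq_of_nhds, iteratedFDeriv_neg_apply, norm_neg]
    exact hbd
  · have he : weight X χ =ᶠ[𝓝 y]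
        ((fun L : Euc d →L[ℝ] Euc d => L.det) ∘ fderiv ℝ (invSymbol X χ)) := by
      filter_upwards [hcont.eventually_const_lt hpos, X.isOpen.mem_nhds hy] with z hz hzX
      rw [h.weight_eq hzX, abs_of_pos hz]
      rfl
    rw [(he.iteratedFDeriv ℝ k).eq_of_nhds]
    exact hbd

end Bounds

/-! ### Sufficiency: equicontinuity of the powers of the push-forward -/

section Sufficiency

variable {d : ℕ} {X : Opens (Euc d)} {ψ χ : Euc d → Euc d}

theorem norm_iteratedFDeriv_pushFun_le (h : IsSymbol X χ) {y : Euc d} (hy : y ∈ X) {i : ℕ}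
    {A D S : ℝ} (hA0 : 0 ≤ A)
    (hA : ∀ k ≤ i, ‖iteratedFDerivWithin ℝ k (weight X χ) X y‖ ≤ A)
    (hD : ∀ k, 1 ≤ k → k ≤ i → ‖iteratedFDerivWithin ℝ k (invSymbol X χ) X y‖ ≤ D ^ k)
    {φ : Euc d → ℂ} (hφ : ContDiff ℝ ∞ φ) (hφS : ∀ j ≤ i, ∀ x, ‖iteratedFDeriv ℝ j φ x‖ ≤ S) :
    ‖iteratedFDeriv ℝ i (pushFun X χ φ) y‖ ≤
      (∑ j ∈ Finset.range (i + 1), (i.choose j : ℝ) * A * ((i - j).factorial * D ^ (i - j))) *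
        S := by
  have heq : iteratedFDeriv ℝ i (pushFun X χ φ) y =
      iteratedFDerivWithin ℝ i (fun y => weight X χ y • (φ ∘ invSymbol X χ) y) X y := by
    rw [← iteratedFDerivWithin_of_isOpen i X.isOpen hy]
    exact iteratedFDerivWithin_congr (fun z hz => pushFun_of_mem hz) hy i
  rw [heq, Finset.sum_mul]
  refine (norm_iteratedFDerivWithin_smul_le (N := ∞) h.contDiffOn_weight
    (hφ.comp_contDiffOn h.contDiffOn_inv) X.isOpen.uniqueDiffOn hy
    (by exact_mod_cast le_top)).trans (Finset.sum_le_sum fun j hj => ?_)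
  have hji : j ≤ i := Nat.lt_succ_iff.1 (Finset.mem_range.1 hj)
  have hc : ‖iteratedFDerivWithin ℝ (i - j) (φ ∘ invSymbol X χ) X y‖ ≤
      (i - j).factorial * S * D ^ (i - j) := by
    refine norm_iteratedFDerivWithin_comp_le (N := ∞) (t := univ) hφ.contDiffOn
      h.contDiffOn_inv (WithTop.coe_le_coe.2 le_top) uniqueDiffOn_univ X.isOpen.uniqueDiffOn
      (mapsTo_univ _ _) hy (fun k hk => ?_) (fun k hk1 hk => hD k hk1 (by omega))
    rw [iteratedFDerivWithin_univ]
    exact hφS k (by omega) _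
  calc (i.choose j : ℝ) * ‖iteratedFDerivWithin ℝ j (weight X χ) X y‖ *
        ‖iteratedFDerivWithin ℝ (i - j) (φ ∘ invSymbol X χ) X y‖
      ≤ (i.choose j : ℝ) * A * ((i - j).factorial * S * D ^ (i - j)) := by
        gcongr
        exact hA j hji
    _ = (i.choose j : ℝ) * A * ((i - j).factorial * D ^ (i - j)) * S := by ring

/-- The derivatives of the inverse iterates, on the images of compact sets, are bounded. -/
def InverseDerivBounded (X : Opens (Euc d)) (ψ : Euc d → Euc d) : Prop :=
  ∀ K ⊆ (X : Set (Euc d)), IsCompact K → ∀ (n : ℕ) (c : Fin d),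
    (⨆ m : ℕ, cnNorm n (ψ^[m] '' K) (fun y => (((invSymbol X ψ)^[m]) y) c)) < ⊤

theorem IsSymbol.contDiffAt_iterate_inv (h : IsSymbol X ψ) (m : ℕ) {y : Euc d} (hy : y ∈ X) :
    ContDiffAt ℝ ∞ (invSymbol X ψ)^[m] y := by
  refine ((h.iterate m).contDiffOn_inv.contDiffAt (X.isOpen.mem_nhds hy)).congr_of_eventuallyEq ?_
  filter_upwards [X.isOpen.mem_nhds hy] with z hz using (h.invSymbol_iterate m hz).symm

theorem InverseDerivBounded.exists_bound (hb : InverseDerivBounded X ψ) (h : IsSymbol X ψ)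
    {K : Set (Euc d)} (hKX : K ⊆ X) (hK : IsCompact K) (n : ℕ) :
    ∃ D : ℝ, ∀ m, ∀ y ∈ ψ^[m] '' K, ∀ k ≤ n,
      ‖iteratedFDerivWithin ℝ k (invSymbol X ψ^[m]) X y‖ ≤ D := by
  obtain ⟨D, hD⟩ := norm_iteratedFDeriv_le_of_iSup_cnNorm_lt_top (n := n)
    (g := fun m => (invSymbol X ψ)^[m]) (K := fun m => ψ^[m] '' K)
    (fun m y hy => h.contDiffAt_iterate_inv m ((h.iterate m).image_subset hKX hy))
    (hb K hKX hK n)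
  refine ⟨D, fun m y hy k hk => ?_⟩
  have hyX : y ∈ (X : Set (Euc d)) := (h.iterate m).image_subset hKX hy
  rw [iteratedFDerivWithin_congr (fun z hz => h.invSymbol_iterate m hz) hyX k,
    iteratedFDerivWithin_of_isOpen k X.isOpen hyX]
  exact hD m y hy k hk

theorem exists_uniform_push_bound (h : IsSymbol X ψ) (hb : InverseDerivBounded X ψ)
    (K : Compacts (Euc d)) (hKX : (K : Set (Euc d)) ⊆ X) (i : ℕ) :
    ∃ P : Seminorm ℝ 𝓓_{K}(Euc d, ℂ), Continuous P ∧ ∀ (m : ℕ) (φ : 𝓓_{K}(Euc d, ℂ)) (y : Euc d),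
      ‖iteratedFDeriv ℝ i (pushFun X ψ^[m] φ) y‖ ≤ P φ := by
  -- One order more than `i`, since the density already contains a first derivative of the inverse.
  obtain ⟨D, hD⟩ := hb.exists_bound h hKX K.isCompact (i + 1)
  obtain ⟨A, hA0, hA⟩ := exists_weight_bound d i D
  set C : ℝ := ∑ j ∈ Finset.range (i + 1),
    (i.choose j : ℝ) * A * ((i - j).factorial * (max 1 D) ^ (i - j)) with hC
  have hC0 : 0 ≤ C := Finset.sum_nonneg fun j _ => by positivity
  let Q : Seminorm ℝ 𝓓_{K}(Euc d, ℂ) := (Finset.range (i + 1)).sup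
    fun j => ContDiffMapSupportedIn.seminorm ℝ (Euc d) ℂ ⊤ K j
  have hQ : Continuous Q := Seminorm.continuous_finsetSup fun j _ =>
    (ContDiffMapSupportedIn.withSeminorms ℝ (Euc d) ℂ ⊤ K).continuous_seminorm j
  let C' : NNReal := ⟨C, hC0⟩
  refine ⟨C' • Q, hQ.const_smul C', fun m φ y => ?_⟩
  rw [smul_apply, NNReal.smul_def, smul_eq_mul]
  change _ ≤ C * Q φ
  have hQ0 : 0 ≤ Q φ := apply_nonneg _ _
  by_cases hy : y ∈ ψ^[m] '' (K : Set (Euc d))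
  · have hyX : y ∈ X := (h.iterate m).image_subset hKX hy
    refine norm_iteratedFDeriv_pushFun_le (h.iterate m) hyX hA0
      (hA X _ (h.iterate m) y hyX (hD m y hy)) (fun k hk1 hk => ?_) φ.contDiff fun j hj x => ?_
    · exact ((hD m y hy k (by omega)).trans (le_max_right 1 D)).trans
        (le_self_pow₀ (le_max_left 1 D) (by omega))
    · exact (ContDiffMapSupportedIn.norm_iteratedFDeriv_apply_le_seminorm_top ℝ).trans
        (Seminorm.le_finset_sup_apply
          (p := fun j => ContDiffMapSupportedIn.seminorm ℝ (Euc d) ℂ ⊤ K j)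
          (Finset.mem_range.2 (Nat.lt_succ_of_le hj)))
  · have hcl : IsClosed (ψ^[m] '' (K : Set (Euc d))) :=
      ((h.iterate m).isCompact_image K.isCompact hKX).isClosed
    have he : pushFun X ψ^[m] φ =ᶠ[𝓝 y] fun _ => (0 : ℂ) := by
      filter_upwards [hcl.isOpen_compl.mem_nhds hy] with z hz
      by_contra hne
      exact hz ((h.iterate m).support_pushFun φ.support_subset hne)
    rw [(he.iteratedFDeriv ℝ i).eq_of_nhds, iteratedFDeriv_fun_zero]
    simpa using mul_nonneg hC0 hQ0

/-- Stable orbits place all the push-forwards in one space 𝓓(L), where `r` is dominated by finitely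
many derivative seminorms; these are bounded uniformly in `m` by `exists_uniform_push_bound`. -/
theorem exists_seminorm_pushTest_pow_le (h : IsSymbol X ψ) (hs : StableOrbits (X : Set (Euc d)) ψ)
    (hb : InverseDerivBounded X ψ) (r : Seminorm ℝ 𝓓(X, ℂ)) (hr : Continuous r)
    (K : Compacts (Euc d)) (hKX : (K : Set (Euc d)) ⊆ X) :
    ∃ P : Seminorm ℝ 𝓓_{K}(Euc d, ℂ), Continuous P ∧ ∀ (m : ℕ) (φ : 𝓓_{K}(Euc d, ℂ)),
      r ((pushTest h ^ m) (TestFunction.ofSupportedIn hKX φ)) ≤ P φ := by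
  obtain ⟨L, hLX, hL, hKL⟩ := hs K hKX K.isCompact
  let L' : Compacts (Euc d) := ⟨L, hL⟩
  have hLX' : (L' : Set (Euc d)) ⊆ X := hLX
  choose P hP hPb using exists_uniform_push_bound h hb K hKX
  let rL : Seminorm ℝ 𝓓_{L'}(Euc d, ℂ) :=
    r.comp (TestFunction.ofSupportedInCLM ℝ hLX').toLinearMap
  have hrL : Continuous rL := hr.comp (TestFunction.continuous_ofSupportedIn hLX')
  obtain ⟨s, C, -, hC⟩ := Seminorm.bound_of_continuous
    (ContDiffMapSupportedIn.withSeminorms ℝ (Euc d) ℂ ⊤ L') rL hrL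
  refine ⟨C • s.sup P, (Seminorm.continuous_finsetSup fun i _ => hP i).const_smul C,
    fun m φ => ?_⟩
  have hsupp : Function.support (pushFun X ψ^[m] φ) ⊆ L :=
    ((h.iterate m).support_pushFun φ.support_subset).trans (hKL m)
  let φm : 𝓓_{L'}(Euc d, ℂ) := ContDiffMapSupportedIn.of_support_subset
    ((h.iterate m).contDiff_pushFun K.isCompact hKX φ.contDiff φ.support_subset) hsupp
  have h1 : (pushTest h ^ m) (TestFunction.ofSupportedIn hKX φ) =
      TestFunction.ofSupportedIn hLX' φm := by
    ext y
    rw [pushTest_pow_apply]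
    rfl
  rw [h1]
  refine (hC φm).trans ?_
  rw [smul_apply, smul_apply, NNReal.smul_def, NNReal.smul_def, smul_eq_mul,
    smul_eq_mul]
  refine mul_le_mul_of_nonneg_left ?_ C.2
  refine Seminorm.finset_sup_apply_le (apply_nonneg _ _) fun i hi => ?_
  refine le_trans ?_ (Seminorm.le_finset_sup_apply hi)
  exact (ContDiffMapSupportedIn.seminorm_top_le_iff ℝ (apply_nonneg _ _) i φm).2
    fun y _ => hPb i m φ y

/-- The witness is the supremum over `m` of `r` composed with the m-th power. It is finite and
continuous because on each 𝓓(K) it is dominated by a continuous seminorm. -/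
theorem exists_seminorm_pushTest_pow (h : IsSymbol X ψ) (hs : StableOrbits (X : Set (Euc d)) ψ)
    (hb : InverseDerivBounded X ψ) (r : Seminorm ℝ 𝓓(X, ℂ)) (hr : Continuous r) :
    ∃ R : Seminorm ℝ 𝓓(X, ℂ), Continuous R ∧ ∀ m φ, r ((pushTest h ^ m) φ) ≤ R φ := by
  have key := exists_seminorm_pushTest_pow_le h hs hb r hr
  let p : ℕ → Seminorm ℝ 𝓓(X, ℂ) := fun m =>
    r.comp ((pushTest h ^ m).toLinearMap.restrictScalars ℝ)
  have hp : ∀ m φ, p m φ = r ((pushTest h ^ m) φ) := fun _ _ => rfl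
  have hbd : ∀ φ, BddAbove (range fun m => p m φ) := fun φ => by
    let K : Compacts (Euc d) := ⟨tsupport φ, φ.hasCompactSupport⟩
    obtain ⟨P, -, hP⟩ := key K φ.tsupport_subset
    exact ⟨_, forall_mem_range.2 fun m =>
      hP m (ContDiffMapSupportedIn.of_support_subset φ.contDiff subset_closure)⟩
  have hbdd : BddAbove (range p) := Seminorm.bddAbove_range_iff.2 hbd
  refine ⟨⨆ m, p m, continuous_seminorm_of_comp_ofSupportedIn _ fun K hK => ?_, fun m φ => ?_⟩
  · obtain ⟨P, hPc, hP⟩ := key K hK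
    let R' : Seminorm ℝ 𝓓_{K}(Euc d, ℂ) :=
      (⨆ m, p m).comp (TestFunction.ofSupportedInCLM ℝ hK).toLinearMap
    have : R' ≤ P := fun φ => by
      change (⨆ m, p m) (TestFunction.ofSupportedIn hK φ) ≤ P φ
      rw [Seminorm.iSup_apply hbdd]
      exact ciSup_le fun m => hP m φ
    exact Seminorm.continuous_of_le hPc this
  · rw [Seminorm.iSup_apply hbdd, ← hp]
    exact le_ciSup (hbd φ) m

set_option synthInstance.maxHeartbeats 400000 in
theorem powerBounded_of_stableOrbits (h : IsSymbol X ψ) (hs : StableOrbits (X : Set (Euc d)) ψ)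
    (hb : InverseDerivBounded X ψ) : PowerBounded (compOp h) := by
  intro p hp
  obtain ⟨B, hB, hBp⟩ := exists_isVonNBounded_of_continuous hp
  obtain ⟨q, hq, hqB⟩ := exists_continuous_seminorm_of_isVonNBounded
    (isVonNBounded_iUnion_image (fun m : ℕ => pushTest h ^ m)
      (exists_seminorm_pushTest_pow h hs hb) hB)
  -- Normalising by an arbitrary t > q u, rather than by q u, covers the case q u = 0.
  refine ⟨q, hq, fun m u => le_of_forall_gt_imp_ge_of_dense fun t ht => ?_⟩
  have ht0 : 0 < t := (apply_nonneg q u).trans_lt ht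
  have h1 : p ((((t⁻¹ : ℝ) : ℂ)) • (compOp h ^ m) u) ≤ 1 := by
    refine hBp _ fun φ hφ => ?_
    have h2 := hqB u _ (mem_iUnion.2 ⟨m, φ, hφ, rfl⟩)
    rw [smul_apply, compOp_pow_apply, norm_smul, Complex.norm_real,
      Real.norm_of_nonneg (inv_nonneg.2 ht0.le), inv_mul_le_one₀ ht0]
    exact h2.trans ht.le
  rw [map_smul_eq_mul, Complex.norm_real, Real.norm_of_nonneg (inv_nonneg.2 ht0.le),
    inv_mul_le_one₀ ht0] at h1
  exact h1

end Sufficiency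

/-! ### Necessity: derivative bounds, supports and stable orbits -/

section Necessity

variable {d : ℕ} {X : Opens (Euc d)} {ψ : Euc d → Euc d}

theorem iteratedFDeriv_test_add (i : ℕ) (f g : 𝓓(X, ℂ)) (y : Euc d) :
    iteratedFDeriv ℝ i (f + g : 𝓓(X, ℂ)) y = iteratedFDeriv ℝ i f y + iteratedFDeriv ℝ i g y :=
  iteratedFDeriv_add_apply (f.contDiff.contDiffAt.of_le (by exact_mod_cast le_top))
    (g.contDiff.contDiffAt.of_le (by exact_mod_cast le_top))

theorem iteratedFDeriv_test_smul {R : Type*} [NormedField R] [NormedSpace R ℂ]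
    [SMulCommClass ℝ R ℂ] (i : ℕ) (c : R) (f : 𝓓(X, ℂ)) (y : Euc d) :
    iteratedFDeriv ℝ i (c • f : 𝓓(X, ℂ)) y = c • iteratedFDeriv ℝ i f y :=
  iteratedFDeriv_const_smul_apply (f.contDiff.contDiffAt.of_le (by exact_mod_cast le_top))

theorem bddAbove_norm_iteratedFDeriv (i : ℕ) (φ : 𝓓(X, ℂ)) :
    BddAbove (range fun x => ‖iteratedFDeriv ℝ i φ x‖) :=
  ⟨_, forall_mem_range.2 fun _ => ContDiffMapSupportedIn.norm_iteratedFDeriv_apply_le_seminorm_top ℝ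
    (f := ContDiffMapSupportedIn.of_support_subset (K := ⟨tsupport φ, φ.hasCompactSupport⟩)
      φ.contDiff subset_closure)⟩

/-- The seminorm `sup ‖D^i φ‖` on `𝓓(X)`. -/
noncomputable def derivSeminorm (X : Opens (Euc d)) (i : ℕ) : Seminorm ℝ 𝓓(X, ℂ) :=
  Seminorm.of (fun φ => ⨆ x, ‖iteratedFDeriv ℝ i φ x‖)
    (fun f g => ciSup_le fun x => by
      rw [iteratedFDeriv_test_add]
      exact (norm_add_le _ _).trans (add_le_add (le_ciSup (bddAbove_norm_iteratedFDeriv i f) x)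
        (le_ciSup (bddAbove_norm_iteratedFDeriv i g) x)))
    (fun c f => by
      simp_rw [iteratedFDeriv_test_smul, norm_smul]
      exact (Real.mul_iSup_of_nonneg (norm_nonneg c) _).symm)

theorem norm_iteratedFDeriv_le_derivSeminorm (i : ℕ) (φ : 𝓓(X, ℂ)) (x : Euc d) :
    ‖iteratedFDeriv ℝ i φ x‖ ≤ derivSeminorm X i φ :=
  le_ciSup (bddAbove_norm_iteratedFDeriv i φ) x

theorem continuous_derivSeminorm (i : ℕ) : Continuous (derivSeminorm X i) := by
  refine continuous_seminorm_of_comp_ofSupportedIn _ fun K hK => ?_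
  let R' : Seminorm ℝ 𝓓_{K}(Euc d, ℂ) :=
    (derivSeminorm X i).comp (TestFunction.ofSupportedInCLM ℝ hK).toLinearMap
  have hle : R' ≤ ContDiffMapSupportedIn.seminorm ℝ (Euc d) ℂ ⊤ K i := fun φ =>
    ciSup_le fun x => ContDiffMapSupportedIn.norm_iteratedFDeriv_apply_le_seminorm_top ℝ
  exact Seminorm.continuous_of_le
    ((ContDiffMapSupportedIn.withSeminorms ℝ (Euc d) ℂ ⊤ K).continuous_seminorm i) hle

theorem exists_deriv_bound_of_isVonNBounded {B : Set 𝓓(X, ℂ)}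
    (hB : Bornology.IsVonNBounded ℂ B) (i : ℕ) :
    ∃ M : ℝ, 0 ≤ M ∧ ∀ φ ∈ B, ∀ x, ‖iteratedFDeriv ℝ i φ x‖ ≤ M := by
  have hU : {φ : 𝓓(X, ℂ) | derivSeminorm X i φ < 1} ∈ 𝓝 0 :=
    (isOpen_lt (continuous_derivSeminorm i) continuous_const).mem_nhds (by simp)
  obtain ⟨a, ha⟩ := (hB hU).exists
  refine ⟨‖a‖, norm_nonneg a, fun φ hφ x => ?_⟩
  obtain ⟨χ, hχ, rfl⟩ := ha hφ
  have h1 : ‖iteratedFDeriv ℝ i χ x‖ ≤ 1 :=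
    (norm_iteratedFDeriv_le_derivSeminorm i χ x).trans (le_of_lt hχ)
  have h2 := iteratedFDeriv_test_smul i a χ x
  calc ‖iteratedFDeriv ℝ i (a • χ : 𝓓(X, ℂ)) x‖ = ‖a‖ * ‖iteratedFDeriv ℝ i χ x‖ := by
        rw [h2, norm_smul]
    _ ≤ ‖a‖ := mul_le_of_le_one_right (norm_nonneg a) h1

/-- Evaluation of the derivative of order `i` at `y` in the directions `v`. -/
noncomputable def derivAt (X : Opens (Euc d)) (i : ℕ) (y : Euc d) (v : Fin i → Euc d) : Distr X :=
  TestFunction.mkCLM ℂ (fun φ => iteratedFDeriv ℝ i φ y v)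
    (fun f g => by rw [iteratedFDeriv_test_add]; rfl)
    (fun c f => by rw [iteratedFDeriv_test_smul]; rfl)
    (fun K hK => by
      have h1 : Continuous fun φ : 𝓓_{K}(Euc d, ℂ) =>
          ContDiffMapSupportedIn.structureMapCLM ℝ ⊤ i φ y v :=
        (continuous_eval_const v).comp ((continuous_eval_const y).comp
          (ContDiffMapSupportedIn.structureMapCLM ℝ ⊤ i).continuous)
      refine h1.congr fun φ => ?_
      rw [ContDiffMapSupportedIn.structureMapCLM_top_apply]
      rfl)

theorem derivAt_apply (i : ℕ) (y : Euc d) (v : Fin i → Euc d) (φ : 𝓓(X, ℂ)) :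
    derivAt X i y v φ = iteratedFDeriv ℝ i φ y v := rfl

set_option synthInstance.maxHeartbeats 400000 in
theorem PowerBounded.exists_seminorm {h : IsSymbol X ψ} (hp : PowerBounded (compOp h))
    (φ : 𝓓(X, ℂ)) : ∃ q : Seminorm ℂ (Distr X), Continuous q ∧
      ∀ (m : ℕ) (u : Distr X), ‖u ((pushTest h ^ m) φ)‖ ≤ q u := by
  obtain ⟨p, hpc, hpφ⟩ := exists_continuous_seminorm_of_isVonNBounded
    (Bornology.isVonNBounded_singleton (𝕜 := ℂ) φ)
  obtain ⟨q, hq, hpq⟩ := hp p hpc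
  refine ⟨q, hq, fun m u => ?_⟩
  rw [← compOp_pow_apply]
  exact (hpφ _ φ rfl).trans (hpq m u)

/-- The functionals `derivAt X i y v` with the product of the ‖v j‖ at most 1 are uniformly bounded,
over all `y`, on the bounded set that controls the dominating seminorm. -/
theorem PowerBounded.exists_deriv_bound {h : IsSymbol X ψ} (hp : PowerBounded (compOp h))
    (φ : 𝓓(X, ℂ)) (i : ℕ) :
    ∃ M : ℝ, 0 ≤ M ∧ ∀ (m : ℕ) (y : Euc d), ‖iteratedFDeriv ℝ i ((pushTest h ^ m) φ) y‖ ≤ M := by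
  obtain ⟨q, hq, hqφ⟩ := hp.exists_seminorm φ
  obtain ⟨B, hB, hBq⟩ := exists_isVonNBounded_of_continuous hq
  obtain ⟨M, hM0, hM⟩ := exists_deriv_bound_of_isVonNBounded hB i
  refine ⟨M, hM0, fun m y => ContinuousMultilinearMap.opNorm_le_bound hM0 fun v => ?_⟩
  refine le_of_forall_gt_imp_ge_of_dense fun t ht => ?_
  have ht0 : 0 < t := lt_of_le_of_lt (by positivity) ht
  have h1 : q (((t⁻¹ : ℝ) : ℂ) • derivAt X i y v) ≤ 1 := by
    refine hBq _ fun χ hχ => ?_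
    rw [smul_apply, derivAt_apply, norm_smul, Complex.norm_real,
      Real.norm_of_nonneg (inv_nonneg.2 ht0.le), inv_mul_le_one₀ ht0]
    refine ((iteratedFDeriv ℝ i χ y).le_opNorm v).trans (le_trans ?_ ht.le)
    gcongr
    exact hM χ hχ y
  have h2 := (hqφ m _).trans h1
  rwa [smul_apply, derivAt_apply, norm_smul, Complex.norm_real,
    Real.norm_of_nonneg (inv_nonneg.2 ht0.le), inv_mul_le_one₀ ht0] at h2

/-- An exhaustion of an open set by compact subsets. -/
theorem exists_exhaustion (X : Opens (Euc d)) : ∃ K : ℕ → Set (Euc d), (∀ j, IsCompact (K j)) ∧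
    (∀ j, K j ⊆ X) ∧ ∀ L ⊆ (X : Set (Euc d)), IsCompact L → ∃ n, ∀ j ≥ n, L ⊆ K j := by
  have : LocallyCompactSpace X := X.isOpen.locallyCompactSpace
  let e : CompactExhaustion X := CompactExhaustion.choice X
  refine ⟨fun j => Subtype.val '' e j, fun j => (e.isCompact j).image continuous_subtype_val,
    fun j => by rintro _ ⟨x, -, rfl⟩; exact x.2, fun L hLX hL => ?_⟩
  have hL' : IsCompact (Subtype.val ⁻¹' L : Set X) := by
    rw [Subtype.isCompact_iff]
    convert hL
    exact (Subtype.image_preimage_coe (X : Set (Euc d)) L).trans (inter_eq_right.2 hLX)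
  obtain ⟨n, hn⟩ := e.exists_superset_of_isCompact hL'
  exact ⟨n, fun j hj x hx => ⟨⟨x, hLX hx⟩, e.subset hj (hn hx), rfl⟩⟩

/-- A compact subset of `X` contains only finitely many of the points, in the sense of indices, so
any coefficients are allowed. The partial sum may be taken as long as desired, which lets a
prescribed term be included. -/
theorem exists_distr_tsum (c : ℕ → ℝ) (y : ℕ → Euc d) (K : ℕ → Set (Euc d))
    (hK : ∀ L ⊆ (X : Set (Euc d)), IsCompact L → ∃ n, ∀ j ≥ n, L ⊆ K j) (hy : ∀ j, y j ∉ K j) :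
    ∃ u : Distr X, ∀ φ : 𝓓(X, ℂ), ∀ N, ∃ n ≥ N,
      u φ = ∑ j ∈ Finset.range n, c j • φ (y j) := by
  have hsum : ∀ L ⊆ (X : Set (Euc d)), IsCompact L → ∃ n, ∀ φ : 𝓓(X, ℂ),
      Function.support φ ⊆ L → ∀ s ⊇ Finset.range n,
        ∑' j, c j • φ (y j) = ∑ j ∈ s, c j • φ (y j) := by
    intro L hLX hL
    obtain ⟨n, hn⟩ := hK L hLX hL
    refine ⟨n, fun φ hφ s hs => tsum_eq_sum fun j hj => ?_⟩
    have hj : n ≤ j := by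
      by_contra hlt
      exact hj (hs (Finset.mem_range.2 (not_le.1 hlt)))
    have : φ (y j) = 0 := by
      by_contra hne
      exact hy j (hn j hj (hφ hne))
    rw [this, smul_zero]
  choose n hn using hsum
  let ev (z : Euc d) : 𝓓(X, ℂ) →L[ℂ] ℂ := derivAt X 0 z (fun _ => 0)
  let u : Distr X := TestFunction.limitCLM ℂ (fun φ => ∑' j, c j • φ (y j))
    (fun L hLX => (∑ j ∈ Finset.range (n L hLX L.isCompact), (c j : ℂ) • ev (y j)) ∘L
      TestFunction.ofSupportedInCLM ℂ hLX)
    (fun L hLX φ => by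
      rw [hn L hLX L.isCompact _ φ.support_subset _ subset_rfl]
      simp [ev, derivAt_apply])
  refine ⟨u, fun φ N => ?_⟩
  let n0 := n (tsupport φ) φ.tsupport_subset φ.hasCompactSupport
  refine ⟨max n0 N, le_max_right _ _, ?_⟩
  exact hn _ φ.tsupport_subset φ.hasCompactSupport φ (subset_tsupport _) _
    (Finset.range_subset_range.2 (le_max_left _ _))

/-- If the supports escaped every compact set, a sum of suitably weighted point masses at the
escaping points would be unbounded along the orbit. Nonnegativity of `φ` rules out cancellation
between the masses. -/
theorem PowerBounded.exists_support_subset {h : IsSymbol X ψ} (hp : PowerBounded (compOp h))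
    (φ : 𝓓(X, ℂ)) (hφ : ∀ x, ∃ r : ℝ, 0 ≤ r ∧ φ x = r) :
    ∃ L ⊆ (X : Set (Euc d)), IsCompact L ∧
      ∀ m : ℕ, Function.support ((pushTest h ^ m) φ) ⊆ L := by
  obtain ⟨K, hKc, hKX, hK⟩ := exists_exhaustion X
  by_contra! hcon
  have h1 : ∀ j, ∃ (m : ℕ) (y : Euc d), (pushTest h ^ m) φ y ≠ 0 ∧ y ∉ K j := fun j => by
    obtain ⟨m, hm⟩ := hcon (K j) (hKX j) (hKc j)
    obtain ⟨y, hy, hyK⟩ := not_subset.1 hm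
    exact ⟨m, y, hy, hyK⟩
  choose m y hne hyK using h1
  have hpos : ∀ m y, ∃ r : ℝ, 0 ≤ r ∧ (pushTest h ^ m) φ y = r := fun m y => by
    by_cases hy : y ∈ X
    · obtain ⟨x, hx, rfl⟩ := (h.iterate m).bij.surjOn hy
      obtain ⟨r, hr, hrx⟩ := hφ x
      refine ⟨invJac ψ^[m] x * r, mul_nonneg ((h.iterate m).invJac_pos hx).le hr, ?_⟩
      rw [pushTest_pow_apply_iterate h m φ hx, hrx, Complex.real_smul, Complex.ofReal_mul]
    · exact ⟨0, le_rfl, by rw [pushTest_pow_of_notMem h m φ hy, Complex.ofReal_zero]⟩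
  choose r hr0 hr using hpos
  have hrpos : ∀ j, 0 < r (m j) (y j) := fun j => by
    refine (hr0 _ _).lt_of_ne fun h0 => hne j ?_
    rw [hr, ← h0, Complex.ofReal_zero]
  -- The weight makes the j-th point mass alone contribute exactly `j` at time `m j`.
  obtain ⟨u, hu⟩ := exists_distr_tsum (X := X) (fun j => j / r (m j) (y j)) y K hK hyK
  obtain ⟨q, -, hq⟩ := hp.exists_seminorm φ
  obtain ⟨j, hj⟩ := exists_nat_gt (q u)
  refine hj.not_ge (le_trans ?_ (hq (m j) u))
  obtain ⟨n, hn, hun⟩ := hu ((pushTest h ^ m j) φ) (j + 1)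
  have h2 : u ((pushTest h ^ m j) φ) =
      ((∑ k ∈ Finset.range n, k / r (m k) (y k) * r (m j) (y k) : ℝ) : ℂ) := by
    rw [hun, Complex.ofReal_sum]
    refine Finset.sum_congr rfl fun k _ => ?_
    rw [hr, Complex.real_smul, Complex.ofReal_mul]
  rw [h2, Complex.norm_real]
  refine le_trans ?_ (le_abs_self _)
  have h3 := Finset.single_le_sum (f := fun k : ℕ => (k : ℝ) / r (m k) (y k) * r (m j) (y k))
    (s := Finset.range n) (fun k _ => mul_nonneg (div_nonneg k.cast_nonneg (hrpos k).le) (hr0 _ _))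
    (Finset.mem_range.2 (by omega : j < n))
  simpa [(hrpos j).ne'] using h3

open scoped Manifold in
/-- A smooth cutoff function which is `1` on a given compact subset of `X`. -/
theorem exists_cutoff {K : Set (Euc d)} (hKX : K ⊆ X) (hK : IsCompact K) :
    ∃ φ : 𝓓(X, ℂ), (∀ x, ∃ r : ℝ, 0 ≤ r ∧ φ x = r) ∧ ∀ x ∈ K, φ x = 1 := by
  obtain ⟨L, hL, hKL, hLX⟩ := exists_compact_between hK X.isOpen hKX
  obtain ⟨f, hf1, hf0, hf⟩ := exists_contMDiffMap_one_nhds_of_subset_interior (n := ⊤)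
    𝓘(ℝ, Euc d) hK.isClosed hKL
  have hfs : ContDiff ℝ ∞ (f : Euc d → ℝ) := f.contMDiff.contDiff
  have hsupp : Function.support (fun x => (f x : ℂ)) ⊆ L := fun x hx => by
    by_contra hxL
    exact hx (by simp [hf0 x hxL])
  refine ⟨⟨fun x => (f x : ℂ), Complex.ofRealCLM.contDiff.comp hfs,
    HasCompactSupport.of_support_subset_isCompact hL hsupp,
    (closure_minimal hsupp hL.isClosed).trans hLX⟩, fun x => ⟨f x, (hf x).1, rfl⟩, fun x hx => ?_⟩
  change ((f x : ℝ) : ℂ) = 1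
  rw [hf1.self_of_nhdsSet x hx, Complex.ofReal_one]

theorem PowerBounded.stableOrbits {h : IsSymbol X ψ} (hp : PowerBounded (compOp h)) :
    StableOrbits (X : Set (Euc d)) ψ := by
  intro K hKX hK
  obtain ⟨φ, hφ, hφ1⟩ := exists_cutoff hKX hK
  obtain ⟨L, hLX, hL, hLs⟩ := hp.exists_support_subset φ hφ
  refine ⟨L, hLX, hL, fun m => ?_⟩
  rintro _ ⟨x, hx, rfl⟩
  refine hLs m ?_
  rw [Function.mem_support, pushTest_pow_apply_iterate h m φ (hKX hx), hφ1 x hx]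
  simpa using ((h.iterate m).invJac_pos (hKX hx)).ne'

end Necessity

/-! ### Compactness and L¹ tools for recurrence -/

section Recurrence

variable {d : ℕ}

/-- A uniformly bounded and uniformly Lipschitz sequence of functions with supports in a common
compact set has two members with far away indices which are uniformly close. -/
theorem exists_uniformly_close {f : ℕ → Euc d → ℂ} {L : Set (Euc d)} (hL : IsCompact L)
    (hsupp : ∀ m, Function.support (f m) ⊆ L) {M₀ M₁ : ℝ} (h0 : ∀ m x, ‖f m x‖ ≤ M₀)
    (h1 : ∀ m x y, ‖f m x - f m y‖ ≤ M₁ * ‖x - y‖) (N : ℕ) {ε : ℝ} (hε : 0 < ε) :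
    ∃ a b, a + N ≤ b ∧ ∀ x, ‖f b x - f a x‖ ≤ ε := by
  have : CompactSpace L := isCompact_iff_compactSpace.1 hL
  have hmod : Tendsto (fun t : ℝ => M₁ * t) (𝓝 0) (𝓝 0) := by
    have h := (continuous_const_mul M₁).tendsto 0
    rwa [mul_zero] at h
  have hcont : ∀ m, Continuous (f m) := fun m =>
    (LipschitzWith.of_dist_le' fun x y => by
      rw [dist_eq_norm, dist_eq_norm]
      exact h1 m x y).continuous
  let g : ℕ → BoundedContinuousFunction L ℂ := fun m =>
    BoundedContinuousFunction.mkOfCompact ⟨fun x => f m x, (hcont m).comp continuous_subtype_val⟩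
  have hcomp : IsCompact (closure (range g)) := by
    refine BoundedContinuousFunction.arzela_ascoli (Metric.closedBall (0 : ℂ) M₀)
      (isCompact_closedBall _ _) _ ?_ ?_
    · rintro _ x ⟨m, rfl⟩
      exact mem_closedBall_zero_iff.2 (h0 m x)
    · refine (Metric.uniformEquicontinuous_of_continuity_modulus _ hmod _ ?_).equicontinuous
      rintro x y ⟨_, m, rfl⟩
      rw [dist_eq_norm, Subtype.dist_eq, dist_eq_norm]
      exact h1 m x y
  obtain ⟨a, -, θ, hθ, hlim⟩ := hcomp.tendsto_subseq fun m => subset_closure (mem_range_self m)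
  obtain ⟨k, hk⟩ := Metric.cauchySeq_iff.1 hlim.cauchySeq ε hε
  -- A strictly increasing `θ` satisfies θ(N + k) ≥ θ(k) + N, which gives the required gap.
  refine ⟨θ k, θ (N + k), by have := hθ.add_le_nat N k; omega, fun x => ?_⟩
  by_cases hx : x ∈ L
  · have h2 := (BoundedContinuousFunction.dist_coe_le_dist (⟨x, hx⟩ : L)).trans
      (hk (N + k) (by omega) k le_rfl).le
    rwa [dist_eq_norm] at h2
  · have h3 : ∀ m, f m x = 0 := fun m => by
      by_contra hne
      exact hx (hsupp m hne)
    simp [h3, hε.le]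

/-- A Lipschitz function with small integral is uniformly small. -/
theorem le_integral_norm_of_lipschitz (M : ℝ) : ∃ δ : ℝ, 0 < δ ∧ ∀ g : Euc d → ℂ, Integrable g →
    (∀ x y, ‖g x - g y‖ ≤ M * ‖x - y‖) → ∀ x, 1 / 2 < ‖g x‖ → δ ≤ ∫ z, ‖g z‖ := by
  -- On a ball of this radius the function varies by at most 1/4, so its norm stays above 1/4 there.
  set r : ℝ := 1 / (4 * (|M| + 1)) with hr
  have hr0 : 0 < r := by positivity
  refine ⟨volume.real (Metric.ball (0 : Euc d) r) * (1 / 4),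
    mul_pos (ENNReal.toReal_pos (Metric.measure_ball_pos _ _ hr0).ne'
      measure_ball_lt_top.ne) (by norm_num), fun g hg hM x hx => ?_⟩
  have h1 : ∀ z ∈ Metric.ball x r, 1 / 4 ≤ ‖g z‖ := fun z hz => by
    have h2 := norm_sub_norm_le (g x) (g z)
    have h3 := hM x z
    have h4 : ‖x - z‖ ≤ r := by
      rw [← dist_eq_norm, dist_comm]
      exact (Metric.mem_ball.1 hz).le
    have h5 : M * ‖x - z‖ ≤ |M| * r :=
      mul_le_mul (le_abs_self M) h4 (norm_nonneg _) (abs_nonneg _)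
    have h6 : |M| * r ≤ 1 / 4 := by
      rw [hr, mul_one_div, div_le_div_iff₀ (by positivity) (by norm_num)]
      linarith [abs_nonneg M]
    linarith
  have hvol : volume.real (Metric.ball (0 : Euc d) r) = volume.real (Metric.ball x r) := by
    rw [measureReal_def, measureReal_def, Measure.addHaar_ball_center volume x]
  calc volume.real (Metric.ball (0 : Euc d) r) * (1 / 4)
      = ∫ _ in Metric.ball x r, (1 / 4 : ℝ) := by rw [setIntegral_const, hvol, smul_eq_mul]
    _ ≤ ∫ z in Metric.ball x r, ‖g z‖ :=
        setIntegral_mono_on (integrableOn_const measure_ball_lt_top.ne) hg.norm.integrableOn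
          measurableSet_ball h1
    _ ≤ ∫ z, ‖g z‖ := setIntegral_le_integral hg.norm (Eventually.of_forall fun _ => norm_nonneg _)

end Recurrence

/-! ### Necessity: recurrence and the lower bound for the density -/

section Necessity

variable {d : ℕ} {X : Opens (Euc d)} {ψ : Euc d → Euc d}

theorem norm_sub_le_of_norm_iteratedFDeriv_one_le {g : Euc d → ℂ} (hg : ContDiff ℝ ∞ g) {M : ℝ}
    (hM : ∀ x, ‖iteratedFDeriv ℝ 1 g x‖ ≤ M) (x y : Euc d) : ‖g x - g y‖ ≤ M * ‖x - y‖ :=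
  convex_univ.norm_image_sub_le_of_norm_fderiv_le
    (fun z _ => (hg.differentiable (by simp)).differentiableAt)
    (fun z _ => by simpa [norm_iteratedFDeriv_one] using hM z) (mem_univ y) (mem_univ x)

/-- The L¹ isometry cancels the common power `a`, turning closeness of two orbit points into a
return to the starting point. -/
theorem integral_norm_sub_pushTest_pow (h : IsSymbol X ψ) (φ : 𝓓(X, ℂ)) {a b : ℕ} (hab : a ≤ b) :
    ∫ y, ‖(pushTest h ^ b) φ y - (pushTest h ^ a) φ y‖ =
      ∫ y, ‖(pushTest h ^ (b - a)) φ y - φ y‖ := by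
  have h1 := integral_norm_pushTest_pow h a ((pushTest h ^ (b - a)) φ - φ)
  have h2 : (pushTest h ^ a) ((pushTest h ^ (b - a)) φ - φ) =
      (pushTest h ^ b) φ - (pushTest h ^ a) φ := by
    rw [map_sub, ← mul_apply_eq_comp, ← pow_add, Nat.add_sub_cancel' hab]
  rw [h2] at h1
  exact h1

/-- The orbit of a nonnegative test function under the push-forward operator returns close to its
starting point: it is relatively compact, and the operator preserves the `L¹` norm. -/
theorem PowerBounded.exists_recurrence {h : IsSymbol X ψ} (hp : PowerBounded (compOp h))
    (φ : 𝓓(X, ℂ)) (hφ : ∀ x, ∃ r : ℝ, 0 ≤ r ∧ φ x = r) (N : ℕ) :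
    ∃ n ≥ N, ∀ x, ‖(pushTest h ^ n) φ x - φ x‖ ≤ 1 / 2 := by
  obtain ⟨L, -, hL, hsupp⟩ := hp.exists_support_subset φ hφ
  obtain ⟨M₀, -, hM₀⟩ := hp.exists_deriv_bound φ 0
  obtain ⟨M₁, -, hM₁⟩ := hp.exists_deriv_bound φ 1
  have h0 : ∀ m x, ‖(pushTest h ^ m) φ x‖ ≤ M₀ := fun m x => by
    rw [← norm_iteratedFDeriv_zero (𝕜 := ℝ) (f := ((pushTest h ^ m) φ : Euc d → ℂ))]
    exact hM₀ m x
  have h1 : ∀ m x y, ‖(pushTest h ^ m) φ x - (pushTest h ^ m) φ y‖ ≤ M₁ * ‖x - y‖ := fun m =>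
    norm_sub_le_of_norm_iteratedFDeriv_one_le ((pushTest h ^ m) φ).contDiff (hM₁ m)
  obtain ⟨δ, hδ, hδb⟩ := le_integral_norm_of_lipschitz (d := d) (2 * M₁)
  set V := volume.real L with hV
  have hV0 : 0 ≤ V := ENNReal.toReal_nonneg
  -- With this ε the L¹ distance is at most εV < δ; the `+ 1` covers V = 0.
  obtain ⟨a, b, hab, hclose⟩ := exists_uniformly_close hL hsupp h0 h1 N
    (ε := δ / (2 * (V + 1))) (by positivity)
  refine ⟨b - a, by omega, fun x => not_lt.1 fun hx => ?_⟩
  have hint : Integrable fun y => (pushTest h ^ (b - a)) φ y - φ y :=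
    (((pushTest h ^ (b - a)) φ).continuous.integrable_of_hasCompactSupport
      ((pushTest h ^ (b - a)) φ).hasCompactSupport).sub
      (φ.continuous.integrable_of_hasCompactSupport φ.hasCompactSupport)
  have h2 := hδb _ hint (fun x y => by
    have e1 := h1 (b - a) x y
    have e2 : ‖φ x - φ y‖ ≤ M₁ * ‖x - y‖ := h1 0 x y
    calc ‖(pushTest h ^ (b - a)) φ x - φ x - ((pushTest h ^ (b - a)) φ y - φ y)‖
        = ‖((pushTest h ^ (b - a)) φ x - (pushTest h ^ (b - a)) φ y) - (φ x - φ y)‖ := by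
          congr 1; ring
      _ ≤ _ := norm_sub_le _ _
      _ ≤ 2 * M₁ * ‖x - y‖ := by linarith) x hx
  rw [← integral_norm_sub_pushTest_pow h φ (by omega : a ≤ b)] at h2
  have hzero : ∀ y ∉ L, ‖(pushTest h ^ b) φ y - (pushTest h ^ a) φ y‖ = 0 := fun y hy => by
    rw [Function.notMem_support.1 fun h' => hy (hsupp b h'),
      Function.notMem_support.1 fun h' => hy (hsupp a h'), sub_zero, norm_zero]
  rw [← setIntegral_eq_integral_of_forall_compl_eq_zero hzero] at h2
  have h3 := (le_abs_self _).trans (norm_setIntegral_le_of_norm_le_const (μ := volume) hL.measure_lt_top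
    (f := fun y => ‖(pushTest h ^ b) φ y - (pushTest h ^ a) φ y‖) (C := δ / (2 * (V + 1)))
    fun y _ => by simpa using hclose y)
  have h4 : δ / (2 * (V + 1)) * V < δ := by
    rw [div_mul_eq_mul_div, div_lt_iff₀ (by positivity)]
    nlinarith
  linarith

theorem PowerBounded.exists_invJac_lower_bound {h : IsSymbol X ψ} (hp : PowerBounded (compOp h))
    {K : Set (Euc d)} (hKX : K ⊆ X) (hK : IsCompact K) :
    ∃ c : ℝ, 0 < c ∧ ∀ (m : ℕ), ∀ x ∈ K, c ≤ invJac ψ^[m] x := by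
  obtain ⟨L, hLX, hL, hKL⟩ := hp.stableOrbits K hKX hK
  obtain ⟨φ, hφ, hφ1⟩ := exists_cutoff hLX hL
  obtain ⟨M, hM0, hM⟩ := hp.exists_deriv_bound φ 0
  have hval : ∀ (n : ℕ), ∀ x ∈ L, (pushTest h ^ n) φ (ψ^[n] x) = invJac ψ^[n] x := fun n x hx => by
    rw [pushTest_pow_apply_iterate h n φ (hLX hx), hφ1 x hx, Complex.real_smul, mul_one]
  refine ⟨1 / (2 * (M + 1)), by positivity, fun m x hx => ?_⟩
  obtain ⟨n, hn, hnφ⟩ := hp.exists_recurrence φ hφ m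
  have hxX : x ∈ X := hKX hx
  -- The cutoff is 1 both at `x` and at ψ^n x, as both lie in `L`, so the recurrence estimate
  -- compares the density directly with 1.
  have h1 : 1 / 2 ≤ invJac ψ^[n] x := by
    have h2 := hnφ (ψ^[n] x)
    rw [hφ1 _ (hKL n ⟨x, hx, rfl⟩), hval n x (hKL 0 ⟨x, hx, rfl⟩), ← Complex.ofReal_one,
      ← Complex.ofReal_sub, Complex.norm_real] at h2
    have := (abs_le.1 h2).1
    linarith
  have h3 : invJac ψ^[n - m] (ψ^[m] x) ≤ M := by
    have h4 := hM (n - m) (ψ^[n - m] (ψ^[m] x))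
    rw [norm_iteratedFDeriv_zero, hval _ _ (hKL m ⟨x, hx, rfl⟩), Complex.norm_real] at h4
    exact (le_abs_self _).trans h4
  -- The left side is at least 1/2 and the first factor at most `M`, so the second factor cannot be
  -- small.
  have h5 : invJac ψ^[n] x = invJac ψ^[n - m] (ψ^[m] x) * invJac ψ^[m] x := by
    rw [← (h.iterate m).invJac_comp (h.iterate (n - m)) hxX, ← Function.iterate_add,
      Nat.sub_add_cancel hn]
  have hpos := (h.iterate m).invJac_pos hxX
  rw [div_le_iff₀ (by positivity)]
  nlinarith

end Necessity

/-! ### Necessity: the inverse iterates as quotients of push-forwards -/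

section Quotient

variable {d : ℕ} {X : Opens (Euc d)} {ψ : Euc d → Euc d}

/-- The derivatives of the real part of a quotient are bounded in terms of those of the numerator
and of the denominator and of a lower bound for the denominator. -/
theorem exists_bound_re_mul_inv (d n : ℕ) {c : ℝ} (hc : 0 < c) (M : ℝ) :
    ∃ B : ℝ, 0 ≤ B ∧ ∀ (S : Set (Euc d)) (f g : Euc d → ℂ), IsOpen S → ContDiff ℝ ∞ f →
      ContDiff ℝ ∞ g → (∀ y ∈ S, g y ≠ 0) → ∀ y ∈ S, c ≤ ‖g y‖ →
        (∀ k ≤ n, ‖iteratedFDeriv ℝ k f y‖ ≤ M) → (∀ k ≤ n, ‖iteratedFDeriv ℝ k g y‖ ≤ M) →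
          ∀ k ≤ n, ‖iteratedFDeriv ℝ k (fun z => (f z * (g z)⁻¹).re) y‖ ≤ B := by
  have hU : IsOpen {p : ℂ × ℂ | p.2 ≠ 0} := isOpen_ne_fun continuous_snd continuous_const
  have hq : ContDiffOn ℝ ∞ (fun p : ℂ × ℂ => (p.1 * p.2⁻¹).re) {p : ℂ × ℂ | p.2 ≠ 0} :=
    Complex.reCLM.contDiff.comp_contDiffOn
      (contDiff_fst.contDiffOn.mul (contDiff_snd.contDiffOn.inv fun _ hp => hp))
  have hK : IsCompact (Metric.closedBall (0 : ℂ × ℂ) M ∩ {p | c ≤ ‖p.2‖}) :=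
    (isCompact_closedBall _ _).inter_right (isClosed_le continuous_const continuous_snd.norm)
  have hKU : Metric.closedBall (0 : ℂ × ℂ) M ∩ {p | c ≤ ‖p.2‖} ⊆ {p : ℂ × ℂ | p.2 ≠ 0} :=
    fun p hp => norm_pos_iff.1 (hc.trans_le hp.2)
  obtain ⟨B, hB0, hB⟩ := exists_bound_comp (E := Euc d) hU hq hK hKU n M
  refine ⟨B, hB0, fun S f g hS hf hg hne y hy hcy hMf hMg k hk => ?_⟩
  have hprod : ∀ k ≤ n, ‖iteratedFDerivWithin ℝ k (fun z => (f z, g z)) S y‖ ≤ M := by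
    intro k hk
    rw [iteratedFDerivWithin_of_isOpen k hS hy, iteratedFDeriv_prodMk hf.contDiffAt hg.contDiffAt
      (by exact_mod_cast le_top), ContinuousMultilinearMap.opNorm_prod]
    exact max_le (hMf k hk) (hMg k hk)
  have h0 : (f y, g y) ∈ Metric.closedBall (0 : ℂ × ℂ) M := by
    rw [mem_closedBall_zero_iff, ← norm_iteratedFDerivWithin_zero (𝕜 := ℝ) (s := S)
      (f := fun z => (f z, g z))]
    exact hprod 0 (Nat.zero_le n)
  have h1 := hB S (fun z => (f z, g z)) hS (hf.prodMk hg).contDiffOn hne y hy ⟨h0, hcy⟩ hprod k hk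
  rwa [iteratedFDerivWithin_of_isOpen k hS hy] at h1

/-- The product of a test function with a coordinate function. -/
noncomputable def coordMul (c : Fin d) (φ : 𝓓(X, ℂ)) : 𝓓(X, ℂ) :=
  ⟨fun x => ((x c : ℝ) : ℂ) * φ x,
    (Complex.ofRealCLM.contDiff.comp
      (EuclideanSpace.proj c : Euc d →L[ℝ] ℝ).contDiff).mul φ.contDiff,
    φ.hasCompactSupport.mul_left,
    (tsupport_mul_subset_right).trans φ.tsupport_subset⟩

theorem coordMul_apply (c : Fin d) (φ : 𝓓(X, ℂ)) (x : Euc d) :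
    coordMul c φ x = ((x c : ℝ) : ℂ) * φ x := rfl

theorem cnNorm_le {n : ℕ} {K : Set (Euc d)} {f : Euc d → ℝ} {B : ℝ}
    (h : ∀ y ∈ K, ∀ k ≤ n, ‖iteratedFDeriv ℝ k f y‖ ≤ B) : cnNorm n K f ≤ ENNReal.ofReal B := by
  refine iSup₂_le fun y hy => iSup₂_le fun k hk => iSup_le fun s => ?_
  rw [← ofReal_norm]
  refine ENNReal.ofReal_le_ofReal ?_
  refine ((iteratedFDeriv ℝ k f y).le_opNorm _).trans (le_trans ?_ (h y hy k hk))
  simp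

/-- Pushing forward x_c φ and φ produces the same density factor, so their quotient recovers the
c-th coordinate of the preimage. Numerator and denominator have uniformly bounded derivatives, and
the denominator is bounded below on ψ^m(K). -/
theorem PowerBounded.inverseDerivBounded {h : IsSymbol X ψ} (hp : PowerBounded (compOp h)) :
    InverseDerivBounded X ψ := by
  intro K hKX hK n c
  obtain ⟨c₀, hc₀, hlow⟩ := hp.exists_invJac_lower_bound hKX hK
  obtain ⟨φ, -, hφ1⟩ := exists_cutoff hKX hK
  choose M hM0 hM using hp.exists_deriv_bound φ
  choose M' hM'0 hM' using hp.exists_deriv_bound (coordMul c φ)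
  set D := ∑ k ∈ Finset.range (n + 1), (M k + M' k) with hD
  have hMD : ∀ k ≤ n, M k + M' k ≤ D := fun k hk =>
    Finset.single_le_sum (f := fun k => M k + M' k) (fun k _ => add_nonneg (hM0 k) (hM'0 k))
      (Finset.mem_range.2 (by omega))
  obtain ⟨B, -, hB⟩ := exists_bound_re_mul_inv d n hc₀ D
  refine (iSup_le fun m => cnNorm_le (B := B) ?_).trans_lt ENNReal.ofReal_lt_top
  rintro _ ⟨x, hx, rfl⟩ k hk
  set f := (pushTest h ^ m) (coordMul c φ) with hf
  set g := (pushTest h ^ m) φ with hg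
  have hxX : x ∈ X := hKX hx
  have hgx : g (ψ^[m] x) = invJac ψ^[m] x := by
    rw [hg, pushTest_pow_apply_iterate h m φ hxX, hφ1 x hx, Complex.real_smul, mul_one]
  have hgx' : c₀ ≤ ‖g (ψ^[m] x)‖ := by
    rw [hgx, Complex.norm_real]
    exact (hlow m x hx).trans (le_abs_self _)
  have hS : IsOpen {y | g y ≠ 0} := isOpen_ne_fun g.continuous continuous_const
  have hyS : ψ^[m] x ∈ {y | g y ≠ 0} := norm_pos_iff.1 (hc₀.trans_le hgx')
  have hbd := hB {y | g y ≠ 0} f g hS f.contDiff g.contDiff (fun y hy => hy) _ hyS hgx'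
    (fun k hk => (hM' k m _).trans (by linarith [hMD k hk, hM0 k]))
    (fun k hk => (hM k m _).trans (by linarith [hMD k hk, hM'0 k])) k hk
  -- The identity holds wherever `g` does not vanish, hence on a whole neighbourhood and not just on
  -- ψ^m(K); derivatives may therefore be compared.
  have he : (fun y => ((invSymbol X ψ)^[m] y) c) =ᶠ[𝓝 (ψ^[m] x)]
      fun z => (f z * (g z)⁻¹).re := by
    filter_upwards [hS.mem_nhds hyS,
      X.isOpen.mem_nhds ((h.iterate m).bij.mapsTo hxX)] with z hz hzX
    obtain ⟨w, hw, rfl⟩ := (h.iterate m).bij.surjOn hzX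
    have hgw : g (ψ^[m] w) = invJac ψ^[m] w • φ w := pushTest_pow_apply_iterate h m φ hw
    have hfw : f (ψ^[m] w) = ((w c : ℝ) : ℂ) * g (ψ^[m] w) := by
      rw [hgw, hf, pushTest_pow_apply_iterate h m _ hw, coordMul_apply, mul_smul_comm]
    have hz' : g (ψ^[m] w) ≠ 0 := hz
    rw [h.iterate_inv_apply m hw, hfw, mul_assoc, mul_inv_cancel₀ hz', mul_one, Complex.ofReal_re]
  rw [(he.iteratedFDeriv ℝ k).eq_of_nhds]
  exact hbd

end Quotient

end CompositionOp

theorem mainTheorem4 {d : ℕ} (X : TopologicalSpace.Opens (CompositionOp.Euc d))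
    (ψ : CompositionOp.Euc d → CompositionOp.Euc d)
    (hψ : ContDiffOn ℝ ∞ ψ X) (hbij : Set.BijOn ψ X X)
    (hdet : ∀ x ∈ X, (fderiv ℝ ψ x).det ≠ 0) :
    CompositionOp.PowerBounded
        (CompositionOp.compOp (CompositionOp.IsSymbol.mk hψ hbij hdet)) ↔
      CompositionOp.StableOrbits (X : Set (CompositionOp.Euc d)) ψ ∧
      ∀ K ⊆ (X : Set (CompositionOp.Euc d)), IsCompact K → ∀ (n : ℕ) (c : Fin d),
        (⨆ m : ℕ, CompositionOp.cnNorm n (ψ^[m] '' K)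
          (fun y => (((CompositionOp.invSymbol X ψ)^[m]) y) c)) < ⊤ :=
  ⟨fun hp => ⟨hp.stableOrbits, hp.inverseDerivBounded⟩,
    fun hs => CompositionOp.powerBounded_of_stableOrbits _ hs.1 hs.2⟩
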